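/- Let $n\ge 1$ be an integer. For real $\alpha,\beta>0$ let $$B^{(\alpha,\beta)}(z,w)=(1-z_1\bar w_1)^{-\alpha}(1-z_2\bar w_2)^{-\beta},\qquad z,w\in\mathbb D^2,$$ and let $K=K^{(\alpha,\beta)}$ be the $(n+1)\times(n+1)$-matrix valued kernel on $\mathbb D$ with entries $$K(z,w)_{ij}=\partial_{z_2}^{\,i}\,\partial_{\bar w_2}^{\,j}B^{(\alpha,\beta)}\big|_{z_1=z_2=z,\;w_1=w_2=w},\qquad 0\le i,j\le n.$$ This kernel is non-negative definite. Let $M^{(\alpha,\beta)}$ be the operator $(Mf)(z)=zf(z)$ on the Hilbert space of $\mathbb C^{n+1}$-valued functions on $\mathbb D$ with reproducing kernel $K$; it is bounded. Put $\widetilde K(z,w)=K(0,0)^{-1/2}K(z,w)K(0,0)^{-1/2}$ and let $\widetilde{\widetilde K}(z,w)=\widetilde K(z,0)^{-1}\widetilde K(z,w)\widetilde K(0,w)^{-1}$ be the normalized kernel. In the frame given by the normalized kernel, the metric of the bundle of eigenspaces $\ker(M^{(\alpha,\beta)*}-\bar z)$ is $h(z)=\widetilde{\widetilde K}(z,z)^t$;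 its curvature is $\mathcal K_h=\bar\partial(h^{-1}\partial h)$. **Theorem.** Let $\alpha,\beta,\widetilde\alpha,\widetilde\beta>0$. The operators $M^{(\alpha,\beta)}$ and $M^{(\widetilde\alpha,\widetilde\beta)}$ (with the same $n$) are unitarily equivalent if and only if $\alpha=\widetilde\alpha$ and $\beta=\widetilde\beta$. Moreover, $\mathcal K_h(0)$ is the transpose of the coefficient of $z\bar w$ in the power series of $\widetilde{\widetilde K}(z,w)$ at $(0,0)$, and it is the diagonal $(n+1)\times(n+1)$ matrix whose diagonal entries are $\alpha$ ($n$ times), followed by $\alpha+(n+1)(\beta+n)$. -/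

import Mathlib

namespace BidiscJet
noncomputable section

open scoped ComplexConjugate InnerProductSpace Complex.UnitDisc

/-- `(a)_p / p!` -/
def pochCoeff (a : ℝ) (p : ℕ) : ℝ := ∏ k ∈ Finset.range p, (a + k) / (k + 1)

theorem pochCoeff_succ (a : ℝ) (p : ℕ) :
    pochCoeff a (p + 1) = pochCoeff a p * ((a + p) / (p + 1)) := by
  rw [pochCoeff, Finset.prod_range_succ, pochCoeff]

theorem pochCoeff_nonneg {a : ℝ} (ha : 0 < a) (p : ℕ) : 0 ≤ pochCoeff a p :=
  Finset.prod_nonneg fun k _ => by positivity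

theorem hasSum_of_eq {ι : Type*} {f g : ι → ℂ} {a : ℂ} (hg : HasSum g a) (h : ∀ t, f t = g t) :
    HasSum f a := by
  rwa [funext h]

theorem hasSum_prod_mul {f g : ℕ → ℂ} {a b : ℂ} (hf : HasSum f a) (hg : HasSum g b) :
    HasSum (fun t : ℕ × ℕ => f t.1 * g t.2) (a * b) := by
  have hs : Summable (fun t : ℕ × ℕ => f t.1 * g t.2) :=
    summable_mul_of_summable_norm (summable_norm_iff.mpr hf.summable)
      (summable_norm_iff.mpr hg.summable)
  exact hf.mul hg hs

theorem choose_eq_pochCoeff (a : ℝ) (p : ℕ) :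
    Ring.choose ((a : ℂ) + p - 1) p = pochCoeff a p := by
  have h := Ring.descPochhammer_eq_factorial_smul_choose ((a : ℂ) + p - 1) p
  have key : (descPochhammer ℤ p).smeval ((a : ℂ) + p - 1) = (p.factorial : ℂ) * pochCoeff a p := by
    rw [Polynomial.descPochhammer_smeval_eq_ascPochhammer,
      show (a : ℂ) + p - 1 - p + 1 = a by ring, Polynomial.ascPochhammer_smeval_eq_eval]
    clear h
    induction p with
    | zero => simp [pochCoeff]
    | succ p ih =>
      rw [ascPochhammer_succ_eval, ih, pochCoeff_succ, Nat.factorial_succ]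
      have : (p : ℂ) + 1 ≠ 0 := by exact_mod_cast p.succ_ne_zero
      push_cast
      field_simp
  rw [key, nsmul_eq_mul] at h
  exact (mul_left_cancel₀ (by exact_mod_cast p.factorial_ne_zero) h).symm

theorem hasSum_cpow (a : ℝ) {x : ℂ} (hx : ‖x‖ < 1) :
    HasSum (fun p => (pochCoeff a p : ℂ) * x ^ p) ((1 - x) ^ (-a : ℂ)) := by
  have h := (Complex.one_div_one_sub_cpow_hasFPowerSeriesOnBall_zero (a : ℂ)).hasSum
    (y := x) (by simpa [enorm_eq_nnnorm, ← NNReal.coe_lt_one] using hx)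
  simpa [choose_eq_pochCoeff, Complex.cpow_neg, mul_comm] using h

theorem differentiableOn_cpow (a : ℝ) {c : ℂ} (hc : ‖c‖ < 1) :
    DifferentiableOn ℂ (fun x => (1 - x * c) ^ (-a : ℂ)) (Metric.ball 0 1) := by
  intro x hx
  have hx : ‖x * c‖ < 1 := by
    rw [norm_mul]
    have : ‖x‖ < 1 := by simpa using hx
    nlinarith [norm_nonneg x, norm_nonneg c]
  refine DifferentiableAt.differentiableWithinAt ?_
  refine DifferentiableAt.cpow_const (by fun_prop) ?_
  have := Complex.mem_slitPlane_of_norm_lt_one (z := -(x * c)) (by simpa using hx)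
  simpa [sub_eq_add_neg] using this

theorem hasSum_iteratedDeriv {F : ℂ → ℂ} {a : ℕ → ℂ}
    (ha : ∀ u ∈ Metric.ball (0 : ℂ) 1, HasSum (fun q => a q * u ^ q) (F u)) (j : ℕ) :
    ∀ u ∈ Metric.ball (0 : ℂ) 1,
      HasSum (fun q => a q * (q.descFactorial j : ℂ) * u ^ (q - j)) (iteratedDeriv j F u) := by
  have hps : HasFPowerSeriesOnBall F (FormalMultilinearSeries.ofScalars ℂ a) 0 1 := by
    refine ⟨?_, by simp, ?_⟩
    · refine ENNReal.le_of_forall_nnreal_lt fun r hr => ?_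
      refine FormalMultilinearSeries.le_radius_of_tendsto _ (l := 0) ?_
      have := (ha (r : ℝ) (by simpa using hr)).summable.norm.tendsto_atTop_zero
      simpa using this
    · intro y hy
      have := ha y (by simpa [enorm_eq_nnnorm, ← NNReal.coe_lt_one] using hy)
      simpa [mul_comm] using this
  have hcoef : ∀ n, iteratedDeriv n F 0 = (n.factorial : ℂ) * a n := by
    intro n
    have := hps.factorial_smul 1 n
    rw [iteratedDeriv_eq_iteratedFDeriv, ← this]
    simp
  have hd : ∀ j, DifferentiableOn ℂ (iteratedDeriv j F) (Metric.ball 0 1) := by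
    intro j
    induction j with
    | zero =>
      have := hps.differentiableOn
      rw [iteratedDeriv_zero]
      rwa [← ENNReal.ofReal_one, Metric.eball_ofReal] at this
    | succ j ih => rw [iteratedDeriv_succ]; exact ih.deriv Metric.isOpen_ball
  intro u hu
  have hT := Complex.hasSum_taylorSeries_on_ball (hd j) hu
  have hinj : Function.Injective (fun n : ℕ => n + j) := fun _ _ h => by simpa using h
  rw [← hinj.hasSum_iff]
  · refine hasSum_of_eq hT fun n => ?_
    rw [iteratedDeriv_eq_iterate, iteratedDeriv_eq_iterate,
      ← Function.iterate_add_apply, ← iteratedDeriv_eq_iterate, hcoef]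
    have h1 : ((n + j).factorial : ℂ) = n.factorial * (n + j).descFactorial j := by
      rw [← Nat.factorial_mul_descFactorial (Nat.le_add_left j n)]; simp
    have h2 : (n.factorial : ℂ) ≠ 0 := by exact_mod_cast n.factorial_ne_zero
    simp only [Function.comp, h1, Nat.add_sub_cancel, smul_eq_mul, sub_zero]
    field_simp
  · intro q hq
    have : q < j := by
      by_contra h
      exact hq ⟨q - j, by simp; omega⟩
    simp [Nat.descFactorial_of_lt this]

/-- The reproducing kernel `(1 - z₁ w̄₁)^(-α) (1 - z₂ w̄₂)^(-β)` of the bidisc. -/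
def bidiscKernel (α β : ℝ) (z w : ℂ × ℂ) : ℂ :=
  (1 - z.1 * conj w.1) ^ (-α : ℂ) * (1 - z.2 * conj w.2) ^ (-β : ℂ)

/-- The jet kernel on the disc: its `(i, j)` entry, `0 ≤ i, j ≤ n`, is `∂^i/∂z₂^i ∂^j/∂w̄₂^j` of the
kernel of the bidisc, restricted to the diagonal `z₁ = z₂ = z`, `w₁ = w₂ = w`. The derivative in
`w̄₂` is the derivative in `u` at `u = w̄` after putting `w₂ = ū`. -/
def jetMatrix (n : ℕ) (α β : ℝ) (z w : ℂ) : Matrix (Fin (n + 1)) (Fin (n + 1)) ℂ :=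
  .of fun i j => iteratedDeriv j (fun u =>
    iteratedDeriv i (fun ζ => bidiscKernel α β (z, ζ) (w, conj u)) z) (conj w)

/-- component `i` of the jet of the monomial `z₁ ^ p z₂ ^ q` along the diagonal -/
def jetMonomial (i p q : ℕ) (z : ℂ) : ℂ := z ^ p * (q.descFactorial i * z ^ (q - i))

theorem hasSum_jetMatrix (n : ℕ) (α β : ℝ) (z w : ℂ) (hz : ‖z‖ < 1) (hw : ‖w‖ < 1)
    (i j : Fin (n + 1)) :
    HasSum (fun t : ℕ × ℕ => ((pochCoeff α t.1 * pochCoeff β t.2 : ℝ) : ℂ) *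
      (jetMonomial i t.1 t.2 z * conj (jetMonomial j t.1 t.2 w))) (jetMatrix n α β z w i j) := by
  have hzw {x y : ℂ} (hx : ‖x‖ < 1) (hy : ‖y‖ < 1) : ‖x * y‖ < 1 := by
    rw [norm_mul]; nlinarith [norm_nonneg x, norm_nonneg y]
  have h1 := hasSum_cpow α (hzw hz (y := conj w) (by simpa using hw))
  have h2 : ∀ u ∈ Metric.ball (0 : ℂ) 1, HasSum (fun q =>
      ((pochCoeff β q : ℂ) * u ^ q) * (q.descFactorial i : ℂ) * z ^ (q - i))
      (iteratedDeriv i (fun ζ => (1 - ζ * u) ^ (-β : ℂ)) z) := by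
    intro u hu
    refine hasSum_iteratedDeriv (F := fun ζ => (1 - ζ * u) ^ (-β : ℂ)) ?_ i z (by simpa using hz)
    intro ζ hζ
    have := hasSum_cpow β (hzw (x := ζ) (y := u) (by simpa using hζ) (by simpa using hu))
    refine hasSum_of_eq this fun q => ?_
    rw [mul_pow]; ring
  have h3 := hasSum_iteratedDeriv
    (F := fun u => iteratedDeriv i (fun ζ => (1 - ζ * u) ^ (-β : ℂ)) z)
    (a := fun q => (pochCoeff β q : ℂ) * (q.descFactorial i : ℂ) * z ^ (q - i))
    (fun u hu => hasSum_of_eq (h2 u hu) fun q => by ring) j (conj w) (by simpa using hw)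
  have h4 : jetMatrix n α β z w i j = (1 - z * conj w) ^ (-α : ℂ) *
      iteratedDeriv j (fun u => iteratedDeriv i (fun ζ => (1 - ζ * u) ^ (-β : ℂ)) z) (conj w) := by
    simp only [jetMatrix, Matrix.of_apply, bidiscKernel, Complex.conj_conj]
    simp only [iteratedDeriv_const_mul_field]
  rw [h4]
  clear h4 h2
  generalize iteratedDeriv j (fun u => iteratedDeriv i (fun ζ => (1 - ζ * u) ^ (-β : ℂ)) z)
    (conj w) = B at h3 ⊢
  generalize (1 - z * conj w) ^ (-α : ℂ) = A at h1 ⊢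
  have h5 := hasSum_prod_mul h1 h3
  refine hasSum_of_eq h5 fun t => ?_
  simp only [jetMonomial, map_mul, map_pow, map_natCast]
  push_cast
  ring

theorem posSemidef_iff {X V : Type*} [NormedAddCommGroup V] [InnerProductSpace ℂ V]
    [CompleteSpace V] (K : Matrix X X (V →L[ℂ] V)) :
    K.PosSemidef ↔ K.IsHermitian ∧ ∀ vv : X →₀ V,
      0 ≤ RCLike.re (vv.sum fun x w => vv.sum fun x' w' => ⟪K x' x w, w'⟫_ℂ) :=
  RKHS.posSemidef_tfae.out 0 2

theorem posSemidef_of_hasSum {X V ι : Type*} [NormedAddCommGroup V] [InnerProductSpace ℂ V]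
    [CompleteSpace V] (K : Matrix X X (V →L[ℂ] V)) (φ : ι → X → V) (c : ι → ℝ)
    (hc : ∀ t, 0 ≤ c t)
    (h : ∀ x y v v', HasSum (fun t => (c t : ℂ) * (⟪φ t y, v⟫_ℂ * ⟪v', φ t x⟫_ℂ)) ⟪v', K x y v⟫_ℂ) :
    K.PosSemidef := by
  have h' : ∀ x y v v', HasSum (fun t => (c t : ℂ) * (⟪v, φ t y⟫_ℂ * ⟪φ t x, v'⟫_ℂ))
      ⟪K x y v, v'⟫_ℂ := by
    intro x y v v'
    have := (h x y v v').map (starRingEnd ℂ) Complex.continuous_conj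
    simpa [Function.comp_def] using this
  refine (posSemidef_iff K).mpr ⟨?_, fun vv => ?_⟩
  · ext x y v
    refine ext_inner_left ℂ fun v' => ?_
    rw [Matrix.conjTranspose_apply, ContinuousLinearMap.star_eq_adjoint,
      ContinuousLinearMap.adjoint_inner_right]
    refine (h' y x v' v).unique ?_
    convert h x y v v' using 3
    ring
  · have hs : HasSum (fun t => vv.sum fun x w => vv.sum fun x' w' =>
        (c t : ℂ) * (⟪w, φ t x⟫_ℂ * ⟪φ t x', w'⟫_ℂ))
        (vv.sum fun x w => vv.sum fun x' w' => ⟪K x' x w, w'⟫_ℂ) :=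
      hasSum_sum fun x _ => hasSum_sum fun x' _ => h' x' x _ _
    refine (Complex.hasSum_re hs).nonneg fun t => ?_
    have : (vv.sum fun x w => vv.sum fun x' w' =>
        (c t : ℂ) * (⟪w, φ t x⟫_ℂ * ⟪φ t x', w'⟫_ℂ)) =
        ((c t * ‖vv.sum fun x w => ⟪φ t x, w⟫_ℂ‖ ^ 2 : ℝ) : ℂ) := by
      push_cast
      rw [← Complex.conj_mul']
      simp only [Finsupp.sum, map_sum, inner_conj_symm]
      rw [Finset.sum_mul_sum]
      simp only [Finset.mul_sum]
    rw [this, Complex.ofReal_re]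
    exact mul_nonneg (hc t) (by positivity)

theorem exists_multiplication {X V H : Type*} [NormedAddCommGroup V] [InnerProductSpace ℂ V]
    [CompleteSpace V] [NormedAddCommGroup H] [InnerProductSpace ℂ H] [CompleteSpace H]
    [RKHS ℂ H X V] (s : X → ℂ) (C : ℝ) (hC : 0 ≤ C)
    (h : Matrix.PosSemidef (.of fun x y => ((C : ℂ) ^ 2 - s x * conj (s y)) • RKHS.kernel H x y)) :
    ∃ T : H →L[ℂ] H, ∀ f x, T f x = s x • f x := by
  let Φ : (X →₀ V) →ₗ[ℂ] H := Finsupp.lsum ℂ fun x => (RKHS.kerFun H x).toLinearMap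
  let Ψ : (X →₀ V) →ₗ[ℂ] H := Finsupp.lsum ℂ fun x => (conj (s x) • RKHS.kerFun H x).toLinearMap
  have hdense : DenseRange Φ := by
    have h1 := RKHS.kerFun_dense (𝕜 := ℂ) (H := H)
    have h2 : Submodule.span ℂ {RKHS.kerFun H x v | (x : X) (v : V)} ≤ LinearMap.range Φ := by
      refine Submodule.span_le.mpr ?_
      rintro _ ⟨x, v, rfl⟩
      exact ⟨Finsupp.single x v, by simp [Φ]⟩
    have h3 := Submodule.topologicalClosure_mono h2
    rw [h1, top_le_iff] at h3
    exact Submodule.dense_iff_topologicalClosure_eq_top.mpr h3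
  have hnorm : ∀ f, ‖Ψ f‖ ≤ C * ‖Φ f‖ := by
    intro f
    have h1 := ((posSemidef_iff _).mp h).2 f
    have h2 : (f.sum fun x w => f.sum fun x' w' =>
        ⟪(Matrix.of fun x y => ((C : ℂ) ^ 2 - s x * conj (s y)) • RKHS.kernel H x y) x' x w, w'⟫_ℂ)
        = (C : ℂ) ^ 2 * ⟪Φ f, Φ f⟫_ℂ - ⟪Ψ f, Ψ f⟫_ℂ := by
      simp only [Φ, Ψ, Finsupp.lsum_apply, Finsupp.sum, sum_inner, inner_sum, Finset.mul_sum,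
        ← Finset.sum_sub_distrib, ContinuousLinearMap.coe_coe, Matrix.of_apply,
        _root_.smul_apply, inner_smul_left, inner_smul_right, RKHS.kernel_inner]
      rw [Finset.sum_comm]
      refine Finset.sum_congr rfl fun x _ => Finset.sum_congr rfl fun x' _ => ?_
      simp only [map_sub, map_mul, map_pow, Complex.conj_ofReal, Complex.conj_conj]
      ring
    rw [h2, inner_self_eq_norm_sq_to_K, inner_self_eq_norm_sq_to_K] at h1
    have h3 : 0 ≤ C ^ 2 * ‖Φ f‖ ^ 2 - ‖Ψ f‖ ^ 2 := by
      convert h1 using 1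
      rw [← Complex.ofReal_re (C ^ 2 * ‖Φ f‖ ^ 2 - ‖Ψ f‖ ^ 2)]
      simp
    refine le_of_sq_le_sq ?_ (by positivity)
    nlinarith
  let S : H →L[ℂ] H := Ψ.extendOfNorm Φ
  have hS : ∀ x v, S (RKHS.kerFun H x v) = conj (s x) • RKHS.kerFun H x v := by
    intro x v
    have := LinearMap.extendOfNorm_eq hdense ⟨C, hnorm⟩ (Finsupp.single x v)
    simpa [Φ, Ψ, S] using this
  refine ⟨ContinuousLinearMap.adjoint S, fun f x => ext_inner_left ℂ fun v => ?_⟩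
  rw [← RKHS.kerFun_inner, ContinuousLinearMap.adjoint_inner_right, hS, inner_smul_left,
    inner_smul_right, RKHS.kerFun_inner, Complex.conj_conj]

/-- `ℂ ^ (n + 1)` with its Euclidean norm -/
abbrev Fibre (n : ℕ) : Type := EuclideanSpace ℂ (Fin (n + 1))

/-- The jet kernel with values in the operators on `ℂ ^ (n + 1)`. -/
def jetKernel (n : ℕ) (α β : ℝ) : Matrix 𝔻 𝔻 (Fibre n →L[ℂ] Fibre n) :=
  .of fun z w => Matrix.toEuclideanCLM (𝕜 := ℂ) (jetMatrix n α β z w)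

/-- The jet, up to order `n`, of the monomial `z₁ ^ p z₂ ^ q` along the diagonal, `t = (p, q)`. -/
def jetMonomialVec (n : ℕ) (t : ℕ × ℕ) (z : 𝔻) : Fibre n :=
  WithLp.toLp 2 fun i => jetMonomial i t.1 t.2 z

theorem hasSum_jetKernel (n : ℕ) (α β : ℝ) (z w : 𝔻) (v v' : Fibre n) :
    HasSum (fun t : ℕ × ℕ => ((pochCoeff α t.1 * pochCoeff β t.2 : ℝ) : ℂ) *
      (⟪jetMonomialVec n t w, v⟫_ℂ * ⟪v', jetMonomialVec n t z⟫_ℂ))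
      ⟪v', jetKernel n α β z w v⟫_ℂ := by
  have h := hasSum_sum (s := Finset.univ) fun i _ => hasSum_sum (s := Finset.univ) fun j _ =>
    (hasSum_jetMatrix n α β z w z.norm_lt_one w.norm_lt_one i j).mul_left (conj (v' i) * v j)
  have e : ⟪v', jetKernel n α β z w v⟫_ℂ =
      ∑ i, ∑ j, conj (v' i) * v j * jetMatrix n α β z w i j := by
    simp only [PiLp.inner_apply, jetKernel, Matrix.of_apply, Matrix.ofLp_toEuclideanCLM,
      Matrix.mulVec, dotProduct, RCLike.inner_apply, Finset.sum_mul]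
    exact Finset.sum_congr rfl fun i _ => Finset.sum_congr rfl fun j _ => by ring
  rw [e]
  refine hasSum_of_eq h fun t => ?_
  simp only [PiLp.inner_apply, jetMonomialVec, RCLike.inner_apply]
  rw [Finset.sum_mul_sum, Finset.sum_comm]
  simp only [Finset.mul_sum]
  exact Finset.sum_congr rfl fun i _ => Finset.sum_congr rfl fun j _ => by ring

theorem posSemidef_jetKernel (n : ℕ) {α β : ℝ} (hα : 0 < α) (hβ : 0 < β) :
    (jetKernel n α β).PosSemidef :=
  posSemidef_of_hasSum _ (jetMonomialVec n) _
    (fun t => mul_nonneg (pochCoeff_nonneg hα t.1) (pochCoeff_nonneg hβ t.2))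
    (hasSum_jetKernel n α β)

instance (n : ℕ) (α β : ℝ) [hα : Fact (0 < α)] [hβ : Fact (0 < β)] :
    Fact (jetKernel n α β).PosSemidef :=
  ⟨posSemidef_jetKernel n hα.out hβ.out⟩

theorem pochCoeff_le {a : ℝ} (ha : 0 < a) (p : ℕ) :
    pochCoeff a p ≤ (1 + 1 / a) * pochCoeff a (p + 1) := by
  have h : (1 : ℝ) ≤ (1 + 1 / a) * ((a + p) / (p + 1)) := by
    have hp : (0 : ℝ) < p + 1 := by positivity
    rw [← mul_div_assoc, one_le_div hp]
    have : (1 + 1 / a) * (a + p) = a + p + 1 + p / a := by field_simp; ring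
    rw [this]
    have : 0 ≤ (p : ℝ) / a := by positivity
    linarith
  rw [pochCoeff_succ]
  nlinarith [pochCoeff_nonneg ha p]

/-- The coefficients of `(C - x) ∑ pochCoeff a p * x ^ p`. -/
def defectCoeff (C a : ℝ) : ℕ → ℝ
  | 0 => C * pochCoeff a 0
  | p + 1 => C * pochCoeff a (p + 1) - pochCoeff a p

theorem posSemidef_defect (n : ℕ) {α β : ℝ} (hα : 0 < α) (hβ : 0 < β) :
    Matrix.PosSemidef (.of fun z w : 𝔻 =>
      (((Real.sqrt (1 + 1 / α) : ℝ) : ℂ) ^ 2 - (z : ℂ) * conj (w : ℂ)) • jetKernel n α β z w) := by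
  have hC : ((Real.sqrt (1 + 1 / α) : ℝ) : ℂ) ^ 2 = ((1 + 1 / α : ℝ) : ℂ) := by
    rw [← Complex.ofReal_pow, Real.sq_sqrt (by positivity)]
  refine posSemidef_of_hasSum _ (jetMonomialVec n)
    (fun t => defectCoeff (1 + 1 / α) α t.1 * pochCoeff β t.2) (fun t => ?_) fun z w v v' => ?_
  · refine mul_nonneg ?_ (pochCoeff_nonneg hβ _)
    rcases t.1 with _ | p
    · exact mul_nonneg (by positivity) (pochCoeff_nonneg hα 0)
    · exact sub_nonneg.mpr (pochCoeff_le hα p)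
  · have h := hasSum_jetKernel n α β z w v v'
    have h1 := h.mul_left ((1 + 1 / α : ℝ) : ℂ)
    have h2 := h.mul_left ((z : ℂ) * conj (w : ℂ))
    have hinj : Function.Injective (fun t : ℕ × ℕ => (t.1 + 1, t.2)) := by
      rintro ⟨a, b⟩ ⟨c, d⟩ hh
      simpa using hh
    let g : ℕ × ℕ → ℂ := fun t => (((match t.1 with | 0 => 0 | p + 1 => pochCoeff α p) *
      pochCoeff β t.2 : ℝ) : ℂ) * (⟪jetMonomialVec n t w, v⟫_ℂ * ⟪v', jetMonomialVec n t z⟫_ℂ)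
    have hm : ∀ (t : ℕ × ℕ) (z : 𝔻),
        jetMonomialVec n (t.1 + 1, t.2) z = (z : ℂ) • jetMonomialVec n t z := by
      intro t z
      ext i
      simp only [jetMonomialVec, jetMonomial, PiLp.smul_apply, smul_eq_mul]
      ring
    have h3 : HasSum g (((z : ℂ) * conj (w : ℂ)) * ⟪v', jetKernel n α β z w v⟫_ℂ) := by
      rw [← hinj.hasSum_iff]
      · refine hasSum_of_eq h2 fun t => ?_
        simp only [g, Function.comp, hm, inner_smul_left, inner_smul_right]
        ring
      · rintro ⟨_ | p, q⟩ hq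
        · simp [g]
        · exact absurd ⟨(p, q), rfl⟩ hq
    have h4 := h1.sub h3
    have e : ⟪v', (Matrix.of fun z w : 𝔻 => (((Real.sqrt (1 + 1 / α) : ℝ) : ℂ) ^ 2 -
        (z : ℂ) * conj (w : ℂ)) • jetKernel n α β z w) z w v⟫_ℂ =
        ((1 + 1 / α : ℝ) : ℂ) * ⟪v', jetKernel n α β z w v⟫_ℂ -
        ((z : ℂ) * conj (w : ℂ)) * ⟪v', jetKernel n α β z w v⟫_ℂ := by
      rw [hC, Matrix.of_apply, _root_.smul_apply, inner_smul_right, sub_mul]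
    rw [e]
    refine hasSum_of_eq h4 ?_
    rintro ⟨_ | p, q⟩
    · simp only [g, defectCoeff]; push_cast; ring
    · simp only [g, defectCoeff]; push_cast; ring

/-- The Hilbert space of functions on `𝔻` with reproducing kernel `jetKernel n α β`. -/
abbrev JetSpace (n : ℕ) (α β : ℝ) [Fact (0 < α)] [Fact (0 < β)] : Type :=
  RKHS.OfKernel (jetKernel n α β)

theorem exists_jetMul (n : ℕ) (α β : ℝ) [hα : Fact (0 < α)] [hβ : Fact (0 < β)] :
    ∃ T : JetSpace n α β →L[ℂ] JetSpace n α β, ∀ f (z : 𝔻), T f z = (z : ℂ) • f z := by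
  refine exists_multiplication (fun z : 𝔻 => (z : ℂ)) _ (Real.sqrt_nonneg (1 + 1 / α)) ?_
  rw [RKHS.OfKernel.kernel_ofKernel]
  exact posSemidef_defect n hα.out hβ.out

/-- The bounded operator `M f (z) = z f (z)`. -/
def jetMul (n : ℕ) (α β : ℝ) [Fact (0 < α)] [Fact (0 < β)] :
    JetSpace n α β →L[ℂ] JetSpace n α β :=
  (exists_jetMul n α β).choose

theorem jetMul_apply (n : ℕ) (α β : ℝ) [Fact (0 < α)] [Fact (0 < β)] (f : JetSpace n α β) (z : 𝔻) :
    jetMul n α β f z = (z : ℂ) • f z :=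
  (exists_jetMul n α β).choose_spec f z

/-- Unitary equivalence of two bounded operators. -/
def UnitarilyEquivalent {H₁ H₂ : Type*} [NormedAddCommGroup H₁] [InnerProductSpace ℂ H₁]
    [NormedAddCommGroup H₂] [InnerProductSpace ℂ H₂] (T₁ : H₁ →L[ℂ] H₁) (T₂ : H₂ →L[ℂ] H₂) : Prop :=
  ∃ U : H₁ ≃ₗᵢ[ℂ] H₂, ∀ f, U (T₁ f) = T₂ (U f)

open scoped MatrixOrder Matrix.Norms.L2Operator in
/-- `K(0,0)^(-1/2) K(z,w) K(0,0)^(-1/2)` for the jet kernel `K`. -/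
def scaledKernel (n : ℕ) (α β : ℝ) (z w : ℂ) : Matrix (Fin (n + 1)) (Fin (n + 1)) ℂ :=
  (CFC.sqrt (jetMatrix n α β 0 0))⁻¹ * jetMatrix n α β z w * (CFC.sqrt (jetMatrix n α β 0 0))⁻¹

/-- The normalized kernel: it is the identity when `w = 0`. -/
def normalizedKernel (n : ℕ) (α β : ℝ) (z w : ℂ) : Matrix (Fin (n + 1)) (Fin (n + 1)) ℂ :=
  (scaledKernel n α β z 0)⁻¹ * scaledKernel n α β z w * (scaledKernel n α β 0 w)⁻¹

/-- The metric `z ↦ K(z,z)ᵗ`, for the normalized kernel `K`, of the bundle of the eigenspaces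
`ker (M^* - z̄)`: up to the transpose, the Gram matrix of the frame of these eigenspaces that is
given by the normalized kernel. -/
def bundleMetric (n : ℕ) (α β : ℝ) (z : ℂ) : Matrix (Fin (n + 1)) (Fin (n + 1)) ℂ :=
  (normalizedKernel n α β z z).transpose

/-- `∂F/∂z`, entry by entry -/
def delMatrix {m : Type*} (F : ℂ → Matrix m m ℂ) (z : ℂ) : Matrix m m ℂ :=
  .of fun i j => (1 / 2 : ℂ) * (fderiv ℝ (fun ζ => F ζ i j) z 1 -
    Complex.I * fderiv ℝ (fun ζ => F ζ i j) z Complex.I)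

/-- `∂F/∂z̄`, entry by entry -/
def delbarMatrix {m : Type*} (F : ℂ → Matrix m m ℂ) (z : ℂ) : Matrix m m ℂ :=
  .of fun i j => (1 / 2 : ℂ) * (fderiv ℝ (fun ζ => F ζ i j) z 1 +
    Complex.I * fderiv ℝ (fun ζ => F ζ i j) z Complex.I)

/-- The curvature `∂̄ (h⁻¹ ∂h)` of a Hermitian metric `h`. -/
def curvature {m : Type*} [Fintype m] [DecidableEq m] (h : ℂ → Matrix m m ℂ) (z : ℂ) :
    Matrix m m ℂ :=
  delbarMatrix (fun ζ => (h ζ)⁻¹ * delMatrix h ζ) z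

/-- The coefficient of `z w̄` in the power series at `(0, 0)` of a kernel `F(z, w)` that is
holomorphic in `z` and `w̄`. -/
def coeffOneOne {m : Type*} (F : ℂ → ℂ → Matrix m m ℂ) : Matrix m m ℂ :=
  .of fun i j => deriv (fun z => deriv (fun u => F z (conj u) i j) 0) 0

end
end BidiscJet

/-!
Write `M` for multiplication by `z`, and `D j = β (β + 1) ⋯ (β + j - 1) j!` for the diagonal entries
of `K(0, 0)`, so that `D (j + 1) / D j = (j + 1) (β + j)`.

*Unitary equivalence.* The curvature at `0` can be read off from `M*` alone. For `x` in `ker M*` let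
`y` be the preimage of `x` under `M*` that is orthogonal to `ker M*`; the ratio `‖y‖² / ‖x‖²` is a
unitary invariant of the pair. The vector `x = K(·, 0) e_j` has the preimage `∂K(·, 0) e_j / ∂w̄`,
which becomes orthogonal to `ker M*` after subtracting `K(·, 0) e_(j + 1)` if `j < n`. The resulting
vectors are orthogonal, with ratio `α` for `j < n` and `α + D (n + 1) / D n = α + (n + 1) (β + n)`
for `j = n` (`isKernelFrame_adjoint_jetMul`). A unitary equivalence makes each ratio of one operator
a weighted mean of the ratios of the other (`IsKernelFrame.exists_weights`), so the least and the
greatest ratio agree, and these determine `α` and `β` when `n ≥ 1`.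

That `ker M*` consists of the `K(·, 0) v` is `eq_zero_of_adjoint_jetMul_eq_zero`. The jets of the
monomials `z₁ ^ p z₂ ^ q` lie in the space and are total (`exists_total_family`, an isometric
embedding into `ℓ²`). An element of `ker M*` is orthogonal to those with `p ≥ 1`; if it vanishes at
`0`, it is orthogonal to those with `p = 0`, `q ≤ n`, and the jet of `z₂ ^ q` for `q > n` is a
combination of jets with `p ≥ 1`, because `(z₁ - z₂) ^ (n + 1)` has the jet zero on the diagonal.

*Curvature.* With `u = w̄` the kernel is a holomorphic function `Ψ(z, u)`. Its normalization
`G = Ψ(z,0)⁻¹ Ψ(z,u) Ψ(0,u)⁻¹` satisfies `G(0, u) = 1`, so that the curvature of `G(z, z̄)ᵗ` at `0`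
is the transpose of the mixed derivative of `G` (`curvature_conj_graph`); if `Ψ(0, 0) = 1`, this
mixed derivative is `∂_z ∂_u Ψ - ∂_z Ψ ∂_u Ψ` at `0` (`deriv_deriv_normalization`). For the scaled
jet kernel the first term is diagonal with entries `α + D (j + 1) / D j`, and the second is diagonal
with entries `D (j + 1) / D j` for `j < n` and `0` for `j = n`.
-/

namespace BidiscJet
noncomputable section

open scoped ComplexConjugate InnerProductSpace Complex.UnitDisc

/-! ### Expansions in reproducing kernel Hilbert spaces -/

theorem denseRange_lsum_kerFun {X V H : Type*} [NormedAddCommGroup V] [InnerProductSpace ℂ V]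
    [CompleteSpace V] [NormedAddCommGroup H] [InnerProductSpace ℂ H] [CompleteSpace H]
    [RKHS ℂ H X V] :
    DenseRange (Finsupp.lsum ℂ fun x => (RKHS.kerFun H x).toLinearMap : (X →₀ V) →ₗ[ℂ] H) := by
  have h1 := RKHS.kerFun_dense (𝕜 := ℂ) (H := H)
  have h2 : Submodule.span ℂ {RKHS.kerFun H x v | (x : X) (v : V)} ≤ LinearMap.range
      (Finsupp.lsum ℂ fun x => (RKHS.kerFun H x).toLinearMap : (X →₀ V) →ₗ[ℂ] H) := by
    refine Submodule.span_le.mpr ?_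
    rintro _ ⟨x, v, rfl⟩
    exact ⟨Finsupp.single x v, by simp⟩
  have h3 := Submodule.topologicalClosure_mono h2
  rw [h1, top_le_iff] at h3
  exact Submodule.dense_iff_topologicalClosure_eq_top.mpr h3

/-- A map defined on the kernel functions of a reproducing kernel Hilbert space that preserves
their inner products extends to an isometry. -/
theorem exists_isometry_of_inner_kerFun {X V H G : Type*} [NormedAddCommGroup V]
    [InnerProductSpace ℂ V] [CompleteSpace V] [NormedAddCommGroup H] [InnerProductSpace ℂ H]
    [CompleteSpace H] [RKHS ℂ H X V] [NormedAddCommGroup G] [InnerProductSpace ℂ G]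
    [CompleteSpace G] (A : X → V →ₗ[ℂ] G)
    (h : ∀ x y v w, ⟪A x v, A y w⟫_ℂ = ⟪RKHS.kerFun H x v, RKHS.kerFun H y w⟫_ℂ) :
    ∃ S : H →ₗᵢ[ℂ] G, ∀ x v, S (RKHS.kerFun H x v) = A x v := by
  let Φ : (X →₀ V) →ₗ[ℂ] H := Finsupp.lsum ℂ fun x => (RKHS.kerFun H x).toLinearMap
  let Ψ : (X →₀ V) →ₗ[ℂ] G := Finsupp.lsum ℂ A
  have hdense : DenseRange Φ := denseRange_lsum_kerFun
  have hnorm : ∀ f, ‖Ψ f‖ = ‖Φ f‖ := by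
    intro f
    have : ⟪Ψ f, Ψ f⟫_ℂ = ⟪Φ f, Φ f⟫_ℂ := by
      simp only [Φ, Ψ, Finsupp.lsum_apply, Finsupp.sum, sum_inner, inner_sum,
        ContinuousLinearMap.coe_coe, h]
    rw [@norm_eq_sqrt_re_inner ℂ, @norm_eq_sqrt_re_inner ℂ H, this]
  have hle : ∀ f, ‖Ψ f‖ ≤ 1 * ‖Φ f‖ := fun f => by rw [hnorm, one_mul]
  let S : H →L[ℂ] G := Ψ.extendOfNorm Φ
  have hS : ∀ f, S (Φ f) = Ψ f := LinearMap.extendOfNorm_eq hdense ⟨1, hle⟩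
  have hSn : ∀ g, ‖S g‖ = ‖g‖ := by
    intro g
    refine hdense.induction_on (p := fun g => ‖S g‖ = ‖g‖) g ?_ fun f => by rw [hS, hnorm]
    exact isClosed_eq (by fun_prop) (by fun_prop)
  refine ⟨⟨S.toLinearMap, hSn⟩, fun x v => ?_⟩
  have := hS (Finsupp.single x v)
  simpa [Φ, Ψ] using this

/-- If the kernel is `∑ c t • φ t ⊗ φ t` with positive weights, then the functions `φ t` lie in the
space, they are total, and every element has an expansion along them that converges pointwise. -/
theorem exists_total_family {X V H ι : Type*} [NormedAddCommGroup V] [InnerProductSpace ℂ V]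
    [CompleteSpace V] [NormedAddCommGroup H] [InnerProductSpace ℂ H] [CompleteSpace H]
    [RKHS ℂ H X V] (φ : ι → X → V) (c : ι → ℝ) (hc : ∀ t, 0 < c t)
    (h : ∀ x y v v', HasSum (fun t => (c t : ℂ) * (⟪φ t y, v⟫_ℂ * ⟪v', φ t x⟫_ℂ))
      ⟪v', RKHS.kernel H x y v⟫_ℂ) :
    ∃ J : ι → H, (∀ t x, J t x = φ t x) ∧ (∀ g, (∀ t, ⟪J t, g⟫_ℂ = 0) → g = 0) ∧
      ∀ g x v, HasSum (fun t => (c t : ℂ) * (⟪v, φ t x⟫_ℂ * ⟪J t, g⟫_ℂ)) ⟪v, g x⟫_ℂ := by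
  classical
  have hsq : ∀ t, ((√(c t) : ℝ) : ℂ) * (√(c t) : ℝ) = c t := fun t => by
    rw [← Complex.ofReal_mul, Real.mul_self_sqrt (hc t).le]
  have hne : ∀ t, ((√(c t) : ℝ) : ℂ) ≠ 0 := fun t => by
    simpa using (Real.sqrt_pos.mpr (hc t)).ne'
  have hmem : ∀ x v, Memℓp (fun t => ((√(c t) : ℝ) : ℂ) * ⟪φ t x, v⟫_ℂ) 2 := by
    intro x v
    refine memℓp_gen ?_
    have h1 := (Complex.hasSum_re (h x x v v)).summable
    refine h1.congr fun t => ?_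
    rw [← inner_conj_symm v, Complex.mul_conj, Complex.normSq_eq_norm_sq, ← Complex.ofReal_mul,
      Complex.ofReal_re]
    simp [mul_pow, abs_of_nonneg (Real.sqrt_nonneg _), Real.sq_sqrt (hc t).le]
  let A : X → V →ₗ[ℂ] lp (fun _ : ι => ℂ) 2 := fun x =>
    { toFun := fun v => ⟨_, hmem x v⟩
      map_add' := fun v w => lp.ext <| funext fun t => by
        simp only [inner_add_right, mul_add]; rfl
      map_smul' := fun a v => lp.ext <| funext fun t => by
        simp [mul_left_comm] }
  have hA : ∀ x v t, A x v t = ((√(c t) : ℝ) : ℂ) * ⟪φ t x, v⟫_ℂ := fun _ _ _ => rfl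
  obtain ⟨S, hS⟩ := exists_isometry_of_inner_kerFun (H := H) A fun x y v w => by
    refine (lp.hasSum_inner (A x v) (A y w)).unique ?_
    rw [RKHS.kerFun_inner, RKHS.kerFun_apply]
    refine hasSum_of_eq (h x y w v) fun t => ?_
    simp only [hA, RCLike.inner_apply, map_mul, Complex.conj_ofReal, inner_conj_symm, ← hsq]
    ring
  have hJ : ∀ t g, ⟪((√(c t) : ℝ) : ℂ)⁻¹ • ContinuousLinearMap.adjoint S.toContinuousLinearMap
      (lp.single 2 t (1 : ℂ)), g⟫_ℂ = ((√(c t) : ℝ) : ℂ)⁻¹ * S g t := fun t g => by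
    simp [ContinuousLinearMap.adjoint_inner_left, lp.inner_single_left, mul_comm]
  refine ⟨fun t => ((√(c t) : ℝ) : ℂ)⁻¹ •
    ContinuousLinearMap.adjoint S.toContinuousLinearMap (lp.single 2 t (1 : ℂ)), ?_, ?_, ?_⟩
  · refine fun t x => ext_inner_right ℂ fun v => ?_
    rw [← RKHS.inner_kerFun, hJ, hS, hA, inv_mul_cancel_left₀ (hne t)]
  · intro g hg
    have : S g = 0 := by
      ext t
      have := hg t
      rw [hJ] at this
      simpa [hne t] using this
    exact S.injective (by rw [this, map_zero])
  · intro g x v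
    have := lp.hasSum_inner (𝕜 := ℂ) (S (RKHS.kerFun H x v)) (S g)
    rw [S.inner_map_map, RKHS.kerFun_inner] at this
    refine hasSum_of_eq this fun t => ?_
    rw [hJ, hS, hA]
    simp only [RCLike.inner_apply, map_mul, Complex.conj_ofReal, inner_conj_symm, ← hsq]
    field_simp [hne t]

/-! ### The kernel of an operator and its minimal preimages -/

/-- A bounded operator `T` whose kernel has the orthogonal basis `a i`, together with the minimal
preimages `y i` of the `a i`: those orthogonal to `ker T`. The `y i` are orthogonal too, `D i` is
the squared norm of `a i`, and `κ i` the ratio of the squared norms of `y i` and `a i`. For the adjoint of multiplication by `z` on a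
space with reproducing kernel `K`, the `κ i` are the eigenvalues of the curvature at `0`. -/
structure IsKernelFrame {ι H : Type*} [Fintype ι] [DecidableEq ι] [NormedAddCommGroup H]
    [InnerProductSpace ℂ H] (T : H →L[ℂ] H) (a y : ι → H) (D κ : ι → ℝ) : Prop where
  pos : ∀ i, 0 < D i
  inner_basis : ∀ i j, ⟪a i, a j⟫_ℂ = if i = j then (D j : ℂ) else 0
  inner_basis_lift : ∀ i j, ⟪a i, y j⟫_ℂ = 0
  inner_lift : ∀ i j, ⟪y i, y j⟫_ℂ = if i = j then ((κ j * D j : ℝ) : ℂ) else 0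
  map_basis : ∀ i, T (a i) = 0
  map_lift : ∀ i, T (y i) = a i
  exists_eq_sum : ∀ x, T x = 0 → ∃ s : ι → ℂ, x = ∑ i, s i • a i

theorem inner_sum_smul_self {ι H : Type*} [Fintype ι] [DecidableEq ι] [NormedAddCommGroup H]
    [InnerProductSpace ℂ H] {a : ι → H} {D : ι → ℝ}
    (h : ∀ i j, ⟪a i, a j⟫_ℂ = if i = j then (D j : ℂ) else 0) (s : ι → ℂ) :
    ⟪∑ i, s i • a i, ∑ i, s i • a i⟫_ℂ = ((∑ i, ‖s i‖ ^ 2 * D i : ℝ) : ℂ) := by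
  simp only [sum_inner, inner_sum, inner_smul_left, inner_smul_right, h]
  push_cast
  refine Finset.sum_congr rfl fun i _ => ?_
  rw [Finset.sum_eq_single i (fun j _ hj => by simp [hj]) (by simp)]
  rw [if_pos rfl, ← Complex.conj_mul']
  ring

/-- A unitary equivalence maps the minimal preimage of a vector in the kernel to the minimal
preimage of its image. So each ratio for the first operator is a weighted mean of the ratios for the
second. -/
theorem IsKernelFrame.exists_weights {ι H H' : Type*} [Fintype ι] [DecidableEq ι]
    [NormedAddCommGroup H] [InnerProductSpace ℂ H] [NormedAddCommGroup H']
    [InnerProductSpace ℂ H'] {T : H →L[ℂ] H} {T' : H' →L[ℂ] H'} {a y : ι → H} {a' y' : ι → H'}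
    {D κ D' κ' : ι → ℝ} (hT : IsKernelFrame T a y D κ) (hT' : IsKernelFrame T' a' y' D' κ')
    (hU : UnitarilyEquivalent T T') (i : ι) :
    ∃ w : ι → ℝ, (∀ j, 0 ≤ w j) ∧ ∑ j, w j = 1 ∧ ∑ j, w j * κ' j = κ i := by
  obtain ⟨U, hU⟩ := hU
  obtain ⟨s, hs⟩ := hT'.exists_eq_sum (U (a i)) (by rw [← hU, hT.map_basis, map_zero])
  have hker : ∀ x, T' x = 0 → ⟪x, U (y i)⟫_ℂ = 0 := by
    intro x hx
    obtain ⟨r, hr⟩ := hT.exists_eq_sum (U.symm x)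
      (U.injective (by rw [hU, U.apply_symm_apply, hx, map_zero]))
    rw [← U.apply_symm_apply x, U.inner_map_map, hr, sum_inner]
    exact Finset.sum_eq_zero fun j _ => by rw [inner_smul_left, hT.inner_basis_lift, mul_zero]
  have hker' : ∀ x, T' x = 0 → ⟪x, ∑ j, s j • y' j⟫_ℂ = 0 := by
    intro x hx
    obtain ⟨r, rfl⟩ := hT'.exists_eq_sum x hx
    simp only [sum_inner, inner_sum, inner_smul_left, inner_smul_right, hT'.inner_basis_lift,
      mul_zero, Finset.sum_const_zero]
  have hd : T' (U (y i) - ∑ j, s j • y' j) = 0 := by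
    rw [map_sub, ← hU, hT.map_lift, hs, map_sum]
    simp [hT'.map_lift]
  have hy : U (y i) = ∑ j, s j • y' j := by
    rw [← sub_eq_zero, ← inner_self_eq_zero (𝕜 := ℂ)]
    refine (inner_sub_right _ _ _).trans ?_
    rw [hker _ hd, hker' _ hd, sub_zero]
  have h1 : ∑ j, ‖s j‖ ^ 2 * D' j = D i := by
    have := inner_sum_smul_self hT'.inner_basis s
    rw [← hs, U.inner_map_map, hT.inner_basis, if_pos rfl] at this
    exact_mod_cast this.symm
  have h2 : ∑ j, ‖s j‖ ^ 2 * (κ' j * D' j) = κ i * D i := by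
    have := inner_sum_smul_self hT'.inner_lift s
    rw [← hy, U.inner_map_map, hT.inner_lift, if_pos rfl] at this
    exact_mod_cast this.symm
  have hD := hT.pos i
  refine ⟨fun j => ‖s j‖ ^ 2 * D' j / D i, fun j => ?_, ?_, ?_⟩
  · have := hT'.pos j
    positivity
  · rw [← Finset.sum_div, h1, div_self hD.ne']
  · rw [eq_comm, ← mul_left_inj' hD.ne', ← h2, Finset.sum_mul]
    refine Finset.sum_congr rfl fun j _ => ?_
    field_simp

theorem IsKernelFrame.le_of_forall_le {ι H H' : Type*} [Fintype ι] [DecidableEq ι]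
    [NormedAddCommGroup H] [InnerProductSpace ℂ H] [NormedAddCommGroup H']
    [InnerProductSpace ℂ H'] {T : H →L[ℂ] H} {T' : H' →L[ℂ] H'} {a y : ι → H} {a' y' : ι → H'}
    {D κ D' κ' : ι → ℝ} (hT : IsKernelFrame T a y D κ) (hT' : IsKernelFrame T' a' y' D' κ')
    (hU : UnitarilyEquivalent T T') {m : ℝ} (hm : ∀ j, m ≤ κ' j) (i : ι) : m ≤ κ i := by
  obtain ⟨w, hw, hw1, hwκ⟩ := hT.exists_weights hT' hU i
  rw [← hwκ, ← one_mul m, ← hw1, Finset.sum_mul]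
  exact Finset.sum_le_sum fun j _ => mul_le_mul_of_nonneg_left (hm j) (hw j)

theorem IsKernelFrame.le_of_forall_ge {ι H H' : Type*} [Fintype ι] [DecidableEq ι]
    [NormedAddCommGroup H] [InnerProductSpace ℂ H] [NormedAddCommGroup H']
    [InnerProductSpace ℂ H'] {T : H →L[ℂ] H} {T' : H' →L[ℂ] H'} {a y : ι → H} {a' y' : ι → H'}
    {D κ D' κ' : ι → ℝ} (hT : IsKernelFrame T a y D κ) (hT' : IsKernelFrame T' a' y' D' κ')
    (hU : UnitarilyEquivalent T T') {m : ℝ} (hm : ∀ j, κ' j ≤ m) (i : ι) : κ i ≤ m := by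
  obtain ⟨w, hw, hw1, hwκ⟩ := hT.exists_weights hT' hU i
  rw [← hwκ, ← one_mul m, ← hw1, Finset.sum_mul]
  exact Finset.sum_le_sum fun j _ => mul_le_mul_of_nonneg_left (hm j) (hw j)

theorem UnitarilyEquivalent.symm {H₁ H₂ : Type*} [NormedAddCommGroup H₁] [InnerProductSpace ℂ H₁]
    [NormedAddCommGroup H₂] [InnerProductSpace ℂ H₂] {T₁ : H₁ →L[ℂ] H₁} {T₂ : H₂ →L[ℂ] H₂}
    (h : UnitarilyEquivalent T₁ T₂) : UnitarilyEquivalent T₂ T₁ := by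
  obtain ⟨U, hU⟩ := h
  exact ⟨U.symm, fun f => U.injective (by simp [hU])⟩

theorem UnitarilyEquivalent.adjoint {H₁ H₂ : Type*} [NormedAddCommGroup H₁]
    [InnerProductSpace ℂ H₁] [NormedAddCommGroup H₂] [InnerProductSpace ℂ H₂] [CompleteSpace H₁]
    [CompleteSpace H₂] {T₁ : H₁ →L[ℂ] H₁} {T₂ : H₂ →L[ℂ] H₂} (h : UnitarilyEquivalent T₁ T₂) :
    UnitarilyEquivalent (ContinuousLinearMap.adjoint T₁) (ContinuousLinearMap.adjoint T₂) := by
  obtain ⟨U, hU⟩ := h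
  refine ⟨U, fun f => ext_inner_right ℂ fun g => ?_⟩
  rw [← U.apply_symm_apply g, U.inner_map_map, ContinuousLinearMap.adjoint_inner_left,
    ContinuousLinearMap.adjoint_inner_left, ← hU, U.inner_map_map]

/-! ### Jets of monomials and the entries of the jet kernel -/

/-- Regrouping a double series along the jets of the monomials by degree gives the power series of
its sum, whose coefficient in degree one comes from the two monomials of degree `j + 1` and order
at least `j` in the second variable. -/
theorem deriv_zero_of_hasSum_jetMonomial {F : ℂ → ℂ} {d : ℕ × ℕ → ℂ} (j : ℕ)
    (h : ∀ u ∈ Metric.ball (0 : ℂ) 1,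
      HasSum (fun t : ℕ × ℕ => d t * jetMonomial j t.1 t.2 u) (F u)) :
    deriv F 0 = d (1, j) * j.factorial + d (0, j + 1) * (j + 1).factorial := by
  -- The degree of the jet. Where the subtraction truncates, `t.2.descFactorial j` vanishes.
  let e : ℕ × ℕ → ℕ := fun t => t.1 + (t.2 - j)
  let a : ℕ → ℂ := fun m => ∑' t : {t // e t = m}, d t.1 * (t.1.2.descFactorial j : ℂ)
  have hF : ∀ u ∈ Metric.ball (0 : ℂ) 1, HasSum (fun m => a m * u ^ m) (F u) := by
    intro u hu
    have h1 := (Equiv.sigmaFiberEquiv e).hasSum_iff.mpr (h u hu)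
    have h2 := h1.sigma fun m => (h1.summable.sigma_factor m).hasSum
    refine hasSum_of_eq h2 fun m => ?_
    rw [← tsum_mul_right]
    refine tsum_congr ?_
    rintro ⟨t, rfl⟩
    simp only [Equiv.sigmaFiberEquiv, Equiv.coe_fn_mk, Function.comp, jetMonomial, e]
    ring
  have h3 := hasSum_iteratedDeriv hF 1 0 (by simp)
  rw [iteratedDeriv_one] at h3
  have h4 := h3.unique (hasSum_single 1 fun m hm => by
    rcases m with _ | _ | m
    · simp
    · simp at hm
    · simp)
  rw [h4]
  simp only [Nat.descFactorial_one, Nat.cast_one, mul_one, Nat.sub_self, pow_zero, a]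
  have h5 := tsum_subtype {t | e t = 1} fun t => d t * (t.2.descFactorial j : ℂ)
  refine h5.trans ?_
  rw [tsum_eq_sum (s := {(1, j), (0, j + 1)})]
  · rw [Finset.sum_pair (by simp)]
    simp [Set.indicator, e, Nat.descFactorial_self]
    left
    have := Nat.factorial_mul_descFactorial (Nat.le_succ j)
    simpa using this
  · rintro ⟨p, q⟩ ht
    rw [Set.indicator_apply]
    split_ifs with hpq
    · have : q < j := by
        by_contra hq
        simp only [e, Set.mem_ofPred_eq] at hpq
        apply ht
        simp only [Finset.mem_insert, Finset.mem_singleton, Prod.mk.injEq]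
        omega
      simp [Nat.descFactorial_of_lt this]
    · rfl

theorem pochCoeff_pos {a : ℝ} (ha : 0 < a) (p : ℕ) : 0 < pochCoeff a p :=
  Finset.prod_pos fun k _ => by positivity

theorem pochCoeff_zero (a : ℝ) : pochCoeff a 0 = 1 := by simp [pochCoeff]

theorem pochCoeff_one (a : ℝ) : pochCoeff a 1 = a := by simp [pochCoeff]

/-- The diagonal entries `β (β + 1) ⋯ (β + j - 1) j!` of the jet kernel at `(0, 0)`. -/
def diagEntry (β : ℝ) (j : ℕ) : ℝ := pochCoeff β j * (j.factorial : ℝ) ^ 2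

theorem diagEntry_pos {β : ℝ} (hβ : 0 < β) (j : ℕ) : 0 < diagEntry β j := by
  have := pochCoeff_pos hβ j
  unfold diagEntry
  positivity

theorem diagEntry_succ (β : ℝ) (j : ℕ) :
    diagEntry β (j + 1) = (j + 1) * (β + j) * diagEntry β j := by
  rw [diagEntry, diagEntry, pochCoeff_succ, Nat.factorial_succ]
  push_cast
  field_simp

theorem jetMonomial_zero (j p q : ℕ) :
    jetMonomial j p q 0 = if p = 0 ∧ q = j then (j.factorial : ℂ) else 0 := by
  rw [jetMonomial]
  rcases lt_trichotomy q j with h | rfl | h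
  · rw [Nat.descFactorial_of_lt h, if_neg (by omega)]
    simp
  · by_cases hp : p = 0
    · simp [hp, Nat.descFactorial_self]
    · simp [hp]
  · rw [if_neg (by omega), zero_pow (by omega : q - j ≠ 0)]
    simp

theorem jetMatrix_zero_right (n : ℕ) (α β : ℝ) {z : ℂ} (hz : ‖z‖ < 1) (i j : Fin (n + 1)) :
    jetMatrix n α β z 0 i j = pochCoeff β j * (j : ℕ).factorial * jetMonomial i 0 j z := by
  refine (hasSum_jetMatrix n α β z 0 hz (by simp) i j).unique ?_
  convert hasSum_single ((0, (j : ℕ)) : ℕ × ℕ) ?_ using 1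
  · simp [jetMonomial_zero, pochCoeff_zero]
    ring
  · rintro ⟨p, q⟩ ht
    rw [jetMonomial_zero, if_neg (by simpa using ht)]
    simp

theorem jetMatrix_zero_left (n : ℕ) (α β : ℝ) {w : ℂ} (hw : ‖w‖ < 1) (i j : Fin (n + 1)) :
    jetMatrix n α β 0 w i j = pochCoeff β i * (i : ℕ).factorial * conj (jetMonomial j 0 i w) := by
  refine (hasSum_jetMatrix n α β 0 w (by simp) hw i j).unique ?_
  convert hasSum_single ((0, (i : ℕ)) : ℕ × ℕ) ?_ using 1
  · simp [jetMonomial_zero, pochCoeff_zero]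
    ring
  · rintro ⟨p, q⟩ ht
    rw [jetMonomial_zero, if_neg (by simpa using ht)]
    simp

theorem jetMatrix_zero_zero (n : ℕ) (α β : ℝ) :
    jetMatrix n α β 0 0 = Matrix.diagonal fun i : Fin (n + 1) => (diagEntry β i : ℂ) := by
  ext i j
  rw [jetMatrix_zero_right n α β (by simp), jetMonomial_zero, Matrix.diagonal_apply, diagEntry]
  by_cases h : i = j
  · subst h
    simp [pow_two, mul_assoc]
  · rw [if_neg h, if_neg (by rw [Fin.ext_iff] at h; omega), mul_zero]

/-- The polynomial `(z₁ - z₂) ^ (n + 1) z₂ ^ m` vanishes on the diagonal to order `n`. -/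
theorem sum_jetMonomial_eq_zero (n m i : ℕ) (hi : i ≤ n) (z : ℂ) :
    ∑ k ∈ Finset.range (n + 2), ((-1) ^ (n + 1 - k) * ((n + 1).choose k : ℂ)) *
      jetMonomial i (n + 1 - k) (m + k) z = 0 := by
  -- Falling factorials of order `i` are polynomials of degree `i`, which the difference operator
  -- of order `n + 1` annihilates.
  have h1 := fwdDiff_iter_eq_sum_shift (1 : ℂ) (fun x => (descPochhammer ℂ i).eval x) (n + 1) m
  rw [Polynomial.fwdDiff_iter_eq_zero_of_degree_lt (by simpa using by omega)] at h1
  have h2 : ∀ k ∈ Finset.range (n + 2), ((-1) ^ (n + 1 - k) * ((n + 1).choose k : ℂ)) *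
      jetMonomial i (n + 1 - k) (m + k) z = ((-1 : ℤ) ^ (n + 1 - k) * ((n + 1).choose k : ℤ)) •
      (descPochhammer ℂ i).eval ((m : ℂ) + k • (1 : ℂ)) * z ^ (n + 1 + m - i) := by
    intro k hk
    rw [Finset.mem_range] at hk
    rw [show (m : ℂ) + k • (1 : ℂ) = ((m + k : ℕ) : ℂ) by simp,
      descPochhammer_eval_eq_descFactorial, jetMonomial]
    rcases lt_or_ge (m + k) i with h | h
    · rw [Nat.descFactorial_of_lt h]
      simp
    · rw [show n + 1 + m - i = (n + 1 - k) + (m + k - i) by omega, pow_add]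
      simp only [zsmul_eq_mul]
      push_cast
      ring
  rw [Finset.sum_congr rfl h2, ← Finset.sum_mul, ← h1]
  simp

theorem deriv_mul_self_zero {φ : ℂ → ℂ} (h : DifferentiableAt ℂ φ 0) :
    deriv (fun z => z * φ z) 0 = φ 0 := by
  rw [deriv_fun_mul differentiableAt_fun_id h]
  simp

theorem deriv_jetMonomial_zero (j p q : ℕ) : deriv (jetMonomial j p q) 0 =
    (if p = 1 ∧ q = j then (j.factorial : ℂ) else 0) +
      if p = 0 ∧ q = j + 1 then ((j + 1).factorial : ℂ) else 0 := by
  rw [deriv_zero_of_hasSum_jetMonomial (d := fun t => if t = (p, q) then 1 else 0) j]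
  · simp only [Prod.mk.injEq, ite_mul, one_mul, zero_mul, eq_comm]
  · intro u _
    convert hasSum_single (p, q) ?_ using 1
    · simp
    · intro t ht
      simp [ht]

/-- Entry `(i, j)` of the derivative of the jet kernel in `w̄` at `w = 0`. -/
def kernelDerivEntry (α β : ℝ) (i j : ℕ) (z : ℂ) : ℂ :=
  α * pochCoeff β j * j.factorial * jetMonomial i 1 j z +
    pochCoeff β (j + 1) * (j + 1).factorial * jetMonomial i 0 (j + 1) z

theorem deriv_kernelDerivEntry (α β : ℝ) (i j : ℕ) : deriv (kernelDerivEntry α β i j) 0 =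
    if i = j then ((α * diagEntry β j + diagEntry β (j + 1) : ℝ) : ℂ) else 0 := by
  unfold kernelDerivEntry
  rw [deriv_fun_add (by unfold jetMonomial; fun_prop) (by unfold jetMonomial; fun_prop),
    deriv_const_mul_field, deriv_const_mul_field]
  change _ * deriv (jetMonomial i 1 j) 0 + _ * deriv (jetMonomial i 0 (j + 1)) 0 = _
  rw [deriv_jetMonomial_zero, deriv_jetMonomial_zero]
  by_cases h : i = j
  · subst h
    simp [diagEntry]
    ring
  · simp [h, Ne.symm h]

/-! ### The Hilbert space of jets and the kernel of the adjoint -/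

section

variable (n : ℕ) (α β : ℝ) [hα : Fact (0 < α)] [hβ : Fact (0 < β)]

theorem exists_jetVector : ∃ J : ℕ × ℕ → JetSpace n α β,
    (∀ t z, J t z = jetMonomialVec n t z) ∧ (∀ g, (∀ t, ⟪J t, g⟫_ℂ = 0) → g = 0) ∧
    ∀ g z v, HasSum (fun t : ℕ × ℕ => ((pochCoeff α t.1 * pochCoeff β t.2 : ℝ) : ℂ) *
      (⟪v, jetMonomialVec n t z⟫_ℂ * ⟪J t, g⟫_ℂ)) ⟪v, g z⟫_ℂ := by
  refine exists_total_family (jetMonomialVec n) (fun t => pochCoeff α t.1 * pochCoeff β t.2)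
    (fun t => mul_pos (pochCoeff_pos hα.out _) (pochCoeff_pos hβ.out _)) ?_
  rw [RKHS.OfKernel.kernel_ofKernel]
  exact hasSum_jetKernel n α β

/-- The jet of the monomial `z₁ ^ p z₂ ^ q`, `t = (p, q)`, as an element of the Hilbert space. -/
def jetVector : ℕ × ℕ → JetSpace n α β := (exists_jetVector n α β).choose

theorem jetVector_apply (t : ℕ × ℕ) (z : 𝔻) : jetVector n α β t z = jetMonomialVec n t z :=
  (exists_jetVector n α β).choose_spec.1 t z

variable {n α β}

theorem eq_zero_of_inner_jetVector {g : JetSpace n α β}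
    (h : ∀ t, ⟪jetVector n α β t, g⟫_ℂ = 0) : g = 0 :=
  (exists_jetVector n α β).choose_spec.2.1 g h

theorem hasSum_inner_jetVector (g : JetSpace n α β) (z : 𝔻) (v : Fibre n) :
    HasSum (fun t : ℕ × ℕ => ((pochCoeff α t.1 * pochCoeff β t.2 : ℝ) : ℂ) *
      (⟪v, jetMonomialVec n t z⟫_ℂ * ⟪jetVector n α β t, g⟫_ℂ)) ⟪v, g z⟫_ℂ :=
  (exists_jetVector n α β).choose_spec.2.2 g z v

variable (n α β)

theorem jetMul_jetVector (t : ℕ × ℕ) :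
    jetMul n α β (jetVector n α β t) = jetVector n α β (t.1 + 1, t.2) := by
  refine RKHS.ext fun z => ?_
  rw [jetMul_apply, jetVector_apply, jetVector_apply]
  ext i
  simp only [jetMonomialVec, jetMonomial, PiLp.smul_apply, smul_eq_mul]
  ring

/-- The kernel function at `0` in the direction of the basis vector `j`. -/
def kernelBasis (j : Fin (n + 1)) : JetSpace n α β :=
  RKHS.kerFun (JetSpace n α β) (0 : 𝔻) (EuclideanSpace.single j 1)

theorem inner_kernelBasis (j : Fin (n + 1)) (g : JetSpace n α β) :
    ⟪kernelBasis n α β j, g⟫_ℂ = g (0 : 𝔻) j := by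
  rw [kernelBasis, RKHS.kerFun_inner, EuclideanSpace.inner_single_left]
  simp

theorem kernelBasis_apply (j : Fin (n + 1)) (z : 𝔻) (i : Fin (n + 1)) :
    kernelBasis n α β j z i = pochCoeff β j * (j : ℕ).factorial * jetMonomial i 0 j z := by
  rw [kernelBasis, RKHS.kerFun_apply, RKHS.OfKernel.kernel_ofKernel, jetKernel, Matrix.of_apply,
    Matrix.ofLp_toEuclideanCLM]
  simp [jetMatrix_zero_right n α β z.norm_lt_one]

theorem kernelBasis_eq_smul (j : Fin (n + 1)) : kernelBasis n α β j =
    ((pochCoeff β j * (j : ℕ).factorial : ℝ) : ℂ) • jetVector n α β (0, j) := by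
  refine RKHS.ext fun z => ?_
  ext i
  rw [kernelBasis_apply, RKHS.coe_smul, Pi.smul_apply, PiLp.smul_apply, jetVector_apply]
  simp [jetMonomialVec]

/-- The derivative in `w̄` at `w = 0` of the kernel functions in the direction of the basis
vector `j`, given by the part of the expansion of the kernel along the monomials that has degree one
in `w̄`. -/
def kernelDeriv (j : Fin (n + 1)) : JetSpace n α β :=
  ((α * pochCoeff β j * (j : ℕ).factorial : ℝ) : ℂ) • jetVector n α β (1, j) +
    ((pochCoeff β (j + 1) * (j + 1 : ℕ).factorial : ℝ) : ℂ) • jetVector n α β (0, j + 1)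

theorem kernelDeriv_apply (j : Fin (n + 1)) (z : 𝔻) (i : Fin (n + 1)) :
    kernelDeriv n α β j z i = kernelDerivEntry α β i j z := by
  rw [kernelDerivEntry, kernelDeriv, RKHS.coe_add, Pi.add_apply, PiLp.add_apply, RKHS.coe_smul,
    Pi.smul_apply, PiLp.smul_apply, jetVector_apply, RKHS.coe_smul, Pi.smul_apply,
    PiLp.smul_apply, jetVector_apply]
  simp [jetMonomialVec]

/-- The reproducing property of `kernelDeriv`. Here `F` is any extension to `ℂ` of the component `j`
of `g`. -/
theorem inner_kernelDeriv (j : Fin (n + 1)) (g : JetSpace n α β) {F : ℂ → ℂ}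
    (hF : ∀ z : 𝔻, F z = g z j) : ⟪kernelDeriv n α β j, g⟫_ℂ = deriv F 0 := by
  rw [deriv_zero_of_hasSum_jetMonomial (F := F) (d := fun t =>
    ((pochCoeff α t.1 * pochCoeff β t.2 : ℝ) : ℂ) * ⟪jetVector n α β t, g⟫_ℂ) j]
  · simp only [kernelDeriv, inner_add_left, inner_smul_left, Complex.conj_ofReal, pochCoeff_zero,
      pochCoeff_one]
    push_cast
    ring
  · intro u hu
    have h := hasSum_inner_jetVector g (Complex.UnitDisc.mk u (by simpa using hu))
      (EuclideanSpace.single j 1)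
    rw [EuclideanSpace.inner_single_left, map_one, one_mul, ← hF] at h
    refine hasSum_of_eq h fun t => ?_
    rw [EuclideanSpace.inner_single_left]
    simp [jetMonomialVec]
    ring

theorem adjoint_jetMul_kernelBasis (j : Fin (n + 1)) :
    ContinuousLinearMap.adjoint (jetMul n α β) (kernelBasis n α β j) = 0 := by
  refine ext_inner_right ℂ fun g => ?_
  rw [ContinuousLinearMap.adjoint_inner_left, inner_kernelBasis, jetMul_apply]
  simp

/-- The derivative in `w̄` at `w = 0` of the eigenvalue equation for the kernel functions at `w`. -/
theorem adjoint_jetMul_kernelDeriv (j : Fin (n + 1)) :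
    ContinuousLinearMap.adjoint (jetMul n α β) (kernelDeriv n α β j) = kernelBasis n α β j := by
  rw [← sub_eq_zero]
  refine eq_zero_of_inner_jetVector fun t => ?_
  rw [inner_sub_right, sub_eq_zero, ContinuousLinearMap.adjoint_inner_right, jetMul_jetVector,
    ← inner_conj_symm, ← inner_conj_symm _ (kernelBasis n α β j), inner_kernelBasis,
    inner_kernelDeriv n α β j _ (F := fun z => z * jetMonomial j t.1 t.2 z), deriv_mul_self_zero]
  · simp [jetVector_apply, jetMonomialVec]
  · unfold jetMonomial
    fun_prop
  · intro z
    simp only [jetVector_apply, jetMonomialVec, jetMonomial]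
    ring

variable {n α β}

/-- The jets of the monomials divisible by `z₁` lie in the range of multiplication by `z`; the other
monomials `z₂ ^ q` are, for `q ≤ n`, multiples of kernel functions at `0`, and for `q > n` they are
congruent, modulo `(z₁ - z₂) ^ (n + 1)`, to a multiple of `z₁`. -/
theorem eq_zero_of_adjoint_jetMul_eq_zero {g : JetSpace n α β}
    (h : ContinuousLinearMap.adjoint (jetMul n α β) g = 0) (h0 : g (0 : 𝔻) = 0) : g = 0 := by
  have h1 : ∀ p q, ⟪jetVector n α β (p + 1, q), g⟫_ℂ = 0 := by
    intro p q
    rw [← jetMul_jetVector n α β (p, q), ← ContinuousLinearMap.adjoint_inner_right, h,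
      inner_zero_right]
  refine eq_zero_of_inner_jetVector ?_
  rintro ⟨_ | p, q⟩
  · rcases lt_or_ge q (n + 1) with hq | hq
    · have h2 := inner_kernelBasis n α β ⟨q, hq⟩ g
      rw [kernelBasis_eq_smul, inner_smul_left, h0, Complex.conj_ofReal] at h2
      have h3 := (pochCoeff_pos hβ.out q).ne'
      have h4 := q.factorial_ne_zero
      simpa [h3, h4] using h2
    · obtain ⟨m, rfl⟩ := Nat.exists_eq_add_of_le' hq
      have h2 : ∑ k ∈ Finset.range (n + 2), ((-1) ^ (n + 1 - k) * ((n + 1).choose k : ℂ)) •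
          jetVector n α β (n + 1 - k, m + k) = 0 := by
        have hsum : ∀ (s : Finset ℕ) (c : ℕ → ℂ) (f : ℕ → JetSpace n α β) (z : 𝔻)
            (i : Fin (n + 1)), (∑ k ∈ s, c k • f k) z i = ∑ k ∈ s, c k * f k z i := by
          intro s c f z i
          have := map_sum (RKHS.coeCLM ℂ (H := JetSpace n α β)) (fun k => c k • f k) s
          simp only [RKHS.coeCLM_apply] at this
          rw [this]
          simp
        refine RKHS.ext fun z => ?_
        ext i
        rw [hsum]
        simp only [jetVector_apply, jetMonomialVec]
        rw [sum_jetMonomial_eq_zero n m i (by omega) z]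
        simp
      have h3 := congrArg (fun f => ⟪f, g⟫_ℂ) h2
      simp only [sum_inner, inner_smul_left, inner_zero_left] at h3
      rw [Finset.sum_range_succ, Finset.sum_eq_zero, zero_add] at h3
      · simpa using h3
      · intro k hk
        rw [Finset.mem_range] at hk
        rw [show n + 1 - k = (n - k) + 1 by omega, h1, mul_zero]
  · exact h1 p q

variable (n α β)

/-! ### Unitary invariants of multiplication by `z` -/

/-- The minimal preimage of a kernel function at `0`: the component of `kernelDeriv` orthogonal to
the kernel functions at `0`. -/
def kernelLift (j : Fin (n + 1)) : JetSpace n α β :=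
  kernelDeriv n α β j -
    if h : (j : ℕ) < n then kernelBasis n α β ⟨j + 1, by omega⟩ else 0

theorem inner_kernelBasis_kernelLift (i j : Fin (n + 1)) :
    ⟪kernelBasis n α β i, kernelLift n α β j⟫_ℂ = 0 := by
  rw [kernelLift, inner_sub_right, inner_kernelBasis, kernelDeriv_apply, Complex.UnitDisc.coe_zero,
    kernelDerivEntry, jetMonomial_zero, jetMonomial_zero, if_neg (by simp), mul_zero, zero_add]
  by_cases hj : (j : ℕ) < n
  · rw [dif_pos hj, inner_kernelBasis, kernelBasis_apply, Complex.UnitDisc.coe_zero,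
      jetMonomial_zero, sub_self]
  · rw [dif_neg hj, inner_zero_right, if_neg (by omega), mul_zero, sub_zero]

/-- The eigenvalues of the curvature at `0`, in the order of the diagonal. -/
def curvatureEigenvalue (n : ℕ) (α β : ℝ) (j : Fin (n + 1)) : ℝ :=
  if j = Fin.last n then α + (n + 1) * (β + n) else α

/-- In each norm but the last, the subtracted kernel function cancels the contribution of the
parameter of the second variable. -/
theorem inner_kernelLift (i j : Fin (n + 1)) :
    ⟪kernelLift n α β i, kernelLift n α β j⟫_ℂ =
      if i = j then ((curvatureEigenvalue n α β j * diagEntry β j : ℝ) : ℂ) else 0 := by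
  have h1 : ⟪kernelLift n α β i, kernelLift n α β j⟫_ℂ =
      ⟪kernelDeriv n α β i, kernelLift n α β j⟫_ℂ := by
    nth_rw 1 [kernelLift]
    rw [inner_sub_left, sub_eq_self]
    split_ifs
    · exact inner_kernelBasis_kernelLift n α β _ j
    · exact inner_zero_left _
  have h2 : ⟪kernelDeriv n α β i, kernelDeriv n α β j⟫_ℂ =
      if i = j then ((α * diagEntry β j + diagEntry β (j + 1) : ℝ) : ℂ) else 0 := by
    rw [inner_kernelDeriv n α β i _ fun z => (kernelDeriv_apply n α β j z i).symm,
      deriv_kernelDerivEntry]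
    simp only [Fin.ext_iff]
  have h3 : ∀ k : Fin (n + 1), ⟪kernelDeriv n α β i, kernelBasis n α β k⟫_ℂ =
      if (k : ℕ) = i + 1 then (diagEntry β (i + 1) : ℂ) else 0 := by
    intro k
    rw [inner_kernelDeriv n α β i _ (F := fun z =>
      pochCoeff β k * (k : ℕ).factorial * jetMonomial i 0 k z)
      fun z => (kernelBasis_apply n α β k z i).symm,
      deriv_const_mul_field]
    change _ * deriv (jetMonomial i 0 k) 0 = _
    rw [deriv_jetMonomial_zero]
    by_cases h4 : (k : ℕ) = i + 1
    · simp [h4, diagEntry, pow_two, mul_assoc]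
    · simp [h4]
  rw [h1, kernelLift, inner_sub_right, h2, curvatureEigenvalue]
  by_cases hj : (j : ℕ) < n
  · rw [dif_pos hj, h3, if_neg (show j ≠ Fin.last n by rw [Ne, Fin.ext_iff, Fin.val_last]; omega)]
    by_cases h : i = j
    · subst h
      simp
    · have h' : (j : ℕ) ≠ i := fun h' => h (Fin.ext h'.symm)
      simp [h, h']
  · have hj' : j = Fin.last n := by rw [Fin.ext_iff, Fin.val_last]; omega
    rw [dif_neg hj, inner_zero_right, sub_zero, if_pos hj', diagEntry_succ]
    split_ifs
    · subst hj'
      rw [Fin.val_last]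
      push_cast
      ring
    · rfl

/-- The kernel functions at `0` are a basis of the kernel of the adjoint of multiplication by `z`,
since an element of this kernel is determined by its value at `0`. -/
theorem isKernelFrame_adjoint_jetMul :
    IsKernelFrame (ContinuousLinearMap.adjoint (jetMul n α β)) (kernelBasis n α β)
      (kernelLift n α β) (fun j => diagEntry β j) (curvatureEigenvalue n α β) where
  pos j := diagEntry_pos hβ.out j
  inner_basis i j := by
    rw [inner_kernelBasis, kernelBasis_apply, Complex.UnitDisc.coe_zero, jetMonomial_zero]
    by_cases h : i = j
    · subst h
      simp [diagEntry, pow_two, mul_assoc]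
    · have h' : (j : ℕ) ≠ i := fun h' => h (Fin.ext h'.symm)
      simp [h, h']
  inner_basis_lift := inner_kernelBasis_kernelLift n α β
  inner_lift := inner_kernelLift n α β
  map_basis := adjoint_jetMul_kernelBasis n α β
  map_lift j := by
    rw [kernelLift, map_sub, adjoint_jetMul_kernelDeriv, sub_eq_self]
    split_ifs
    · exact adjoint_jetMul_kernelBasis n α β _
    · exact map_zero _
  exists_eq_sum x hx := by
    refine ⟨fun j => x (0 : 𝔻) j / diagEntry β j, ?_⟩
    rw [← sub_eq_zero]
    refine eq_zero_of_adjoint_jetMul_eq_zero ?_ ?_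
    · simp [map_sub, map_sum, hx, adjoint_jetMul_kernelBasis]
    · ext i
      rw [← inner_kernelBasis, inner_sub_right, inner_sum, inner_kernelBasis,
        Finset.sum_eq_single i]
      · rw [inner_smul_right, inner_kernelBasis, kernelBasis_apply, Complex.UnitDisc.coe_zero,
          jetMonomial_zero, if_pos ⟨rfl, rfl⟩]
        have h1 := (pochCoeff_pos hβ.out i).ne'
        have h2 := (i : ℕ).factorial_ne_zero
        have h3 : ((diagEntry β i : ℝ) : ℂ) ≠ 0 := by exact_mod_cast (diagEntry_pos hβ.out i).ne'
        have h4 : (diagEntry β i : ℂ) = pochCoeff β i * (i : ℕ).factorial * (i : ℕ).factorial := by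
          rw [diagEntry]
          push_cast
          ring
        rw [← h4, div_mul_cancel₀ _ h3]
        simp
      · intro j _ hj
        have h' : (j : ℕ) ≠ i := fun h' => hj (Fin.ext h')
        rw [inner_smul_right, inner_kernelBasis, kernelBasis_apply, Complex.UnitDisc.coe_zero,
          jetMonomial_zero, if_neg (fun h => h' h.2), mul_zero, mul_zero]
      · simp

end

theorem unitarilyEquivalent_jetMul_iff (n : ℕ) (hn : 1 ≤ n) (α β α' β' : ℝ) [hα : Fact (0 < α)]
    [hβ : Fact (0 < β)] [hα' : Fact (0 < α')] [hβ' : Fact (0 < β')] :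
    UnitarilyEquivalent (jetMul n α β) (jetMul n α' β') ↔ α = α' ∧ β = β' := by
  refine ⟨fun h => ?_, ?_⟩
  · -- The least eigenvalue is `α`, which uses `1 ≤ n`, and the greatest is `α + (n + 1) (β + n)`.
    have hF := isKernelFrame_adjoint_jetMul n α β
    have hF' := isKernelFrame_adjoint_jetMul n α' β'
    have h0 : ∀ α β, curvatureEigenvalue n α β 0 = α := fun α β =>
      if_neg (by rw [Fin.ext_iff, Fin.val_last]; exact (Nat.ne_of_gt hn).symm)
    have hl : ∀ α β, curvatureEigenvalue n α β (Fin.last n) = α + (n + 1) * (β + n) := fun α β =>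
      if_pos rfl
    have hmin : ∀ (α : ℝ) {β : ℝ}, 0 < β → ∀ j, α ≤ curvatureEigenvalue n α β j := by
      intro α β hβ j
      unfold curvatureEigenvalue
      split_ifs
      · have : 0 ≤ ((n : ℝ) + 1) * (β + n) := by positivity
        linarith
      · exact le_rfl
    have hmax : ∀ (α : ℝ) {β : ℝ}, 0 < β →
        ∀ j, curvatureEigenvalue n α β j ≤ α + (n + 1) * (β + n) := by
      intro α β hβ j
      unfold curvatureEigenvalue
      split_ifs
      · exact le_rfl
      · have : 0 ≤ ((n : ℝ) + 1) * (β + n) := by positivity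
        linarith
    have e1 := hF.le_of_forall_le hF' h.adjoint (hmin α' hβ'.out) 0
    have e2 := hF'.le_of_forall_le hF h.symm.adjoint (hmin α hβ.out) 0
    have e3 := hF.le_of_forall_ge hF' h.adjoint (hmax α' hβ'.out) (Fin.last n)
    have e4 := hF'.le_of_forall_ge hF h.symm.adjoint (hmax α hβ.out) (Fin.last n)
    rw [h0] at e1 e2
    rw [hl] at e3 e4
    have e5 : α = α' := le_antisymm e2 e1
    subst e5
    refine ⟨rfl, ?_⟩
    have e6 : ((n : ℝ) + 1) * (β + n) = (n + 1) * (β' + n) := by linarith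
    have e7 := mul_left_cancel₀ (by positivity) e6
    linarith
  · rintro ⟨rfl, rfl⟩
    exact ⟨LinearIsometryEquiv.refl ℂ _, fun f => rfl⟩

/-! ### Partial derivatives of holomorphic functions of two variables -/

section

variable {E : Type*} [NormedAddCommGroup E] [NormedSpace ℂ E]

theorem analyticAt_clm_apply {F G : Type*} [NormedAddCommGroup F] [NormedSpace ℂ F]
    [NormedAddCommGroup G] [NormedSpace ℂ G] {L : G → F →L[ℂ] E} {x : G}
    (h : AnalyticAt ℂ L x) (v : F) : AnalyticAt ℂ (fun y => L y v) x :=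
  ((ContinuousLinearMap.apply ℂ E v).analyticAt _).comp h

theorem deriv_comp_prodMk_left {F : ℂ × ℂ → E} {z u : ℂ} (h : DifferentiableAt ℂ F (z, u)) :
    deriv (fun ζ => F (ζ, u)) z = fderiv ℂ F (z, u) (1, 0) :=
  (h.hasFDerivAt.comp_hasDerivAt z ((hasDerivAt_id z).prodMk (hasDerivAt_const z u))).deriv

theorem deriv_comp_prodMk_right {F : ℂ × ℂ → E} {z u : ℂ} (h : DifferentiableAt ℂ F (z, u)) :
    deriv (fun ζ => F (z, ζ)) u = fderiv ℂ F (z, u) (0, 1) :=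
  (h.hasFDerivAt.comp_hasDerivAt u ((hasDerivAt_const u z).prodMk (hasDerivAt_id u))).deriv

variable [CompleteSpace E]

theorem deriv_deriv_eq_fderiv_left {F : ℂ × ℂ → E} (h : AnalyticAt ℂ F (0, 0)) :
    deriv (fun u => deriv (fun z => F (z, u)) 0) 0 =
      fderiv ℂ (fun x => fderiv ℂ F x (1, 0)) (0, 0) (0, 1) := by
  rw [← deriv_comp_prodMk_right (h.fderiv.differentiableAt.clm_apply
    (differentiableAt_const _))]
  refine Filter.EventuallyEq.deriv_eq ?_
  have h1 : Filter.Tendsto (fun u : ℂ => ((0 : ℂ), u)) (nhds 0) (nhds (0, 0)) :=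
    (by fun_prop : Continuous fun u : ℂ => ((0 : ℂ), u)).tendsto 0
  filter_upwards [h1.eventually h.eventually_analyticAt] with u hu
  exact deriv_comp_prodMk_left hu.differentiableAt

theorem deriv_deriv_eq_fderiv_right {F : ℂ × ℂ → E} (h : AnalyticAt ℂ F (0, 0)) :
    deriv (fun z => deriv (fun u => F (z, u)) 0) 0 =
      fderiv ℂ (fun x => fderiv ℂ F x (0, 1)) (0, 0) (1, 0) := by
  rw [← deriv_comp_prodMk_left (h.fderiv.differentiableAt.clm_apply
    (differentiableAt_const _))]
  refine Filter.EventuallyEq.deriv_eq ?_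
  have h1 : Filter.Tendsto (fun z : ℂ => (z, (0 : ℂ))) (nhds 0) (nhds (0, 0)) :=
    (by fun_prop : Continuous fun z : ℂ => (z, (0 : ℂ))).tendsto 0
  filter_upwards [h1.eventually h.eventually_analyticAt] with u hu
  exact deriv_comp_prodMk_right hu.differentiableAt

theorem deriv_deriv_comm {F : ℂ × ℂ → E} (h : AnalyticAt ℂ F (0, 0)) :
    deriv (fun u => deriv (fun z => F (z, u)) 0) 0 =
      deriv (fun z => deriv (fun u => F (z, u)) 0) 0 := by
  rw [deriv_deriv_eq_fderiv_left h, deriv_deriv_eq_fderiv_right h,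
    fderiv_clm_apply h.fderiv.differentiableAt (differentiableAt_const _),
    fderiv_clm_apply h.fderiv.differentiableAt (differentiableAt_const _)]
  simpa using (h.contDiffAt (n := ⊤)).isSymmSndFDerivAt (by simp) (0, 1) (1, 0)

theorem analyticOnNhd_iteratedDeriv_left {F : ℂ × ℂ → E} {U : Set (ℂ × ℂ)} (hU : IsOpen U)
    (h : AnalyticOnNhd ℂ F U) (i : ℕ) :
    AnalyticOnNhd ℂ (fun x => iteratedDeriv i (fun ζ => F (ζ, x.2)) x.1) U := by
  induction i with
  | zero => simpa using h
  | succ i ih =>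
    have h1 : AnalyticOnNhd ℂ (fun x => fderiv ℂ
        (fun x : ℂ × ℂ => iteratedDeriv i (fun ζ => F (ζ, x.2)) x.1) x (1, 0)) U :=
      fun x hx => analyticAt_clm_apply (ih.fderiv x hx) _
    refine h1.congr hU fun x hx => ?_
    rw [iteratedDeriv_succ]
    exact (deriv_comp_prodMk_left (ih x hx).differentiableAt).symm

theorem analyticOnNhd_iteratedDeriv_right {F : ℂ × ℂ → E} {U : Set (ℂ × ℂ)} (hU : IsOpen U)
    (h : AnalyticOnNhd ℂ F U) (i : ℕ) :
    AnalyticOnNhd ℂ (fun x => iteratedDeriv i (fun ζ => F (x.1, ζ)) x.2) U := by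
  induction i with
  | zero => simpa using h
  | succ i ih =>
    have h1 : AnalyticOnNhd ℂ (fun x => fderiv ℂ
        (fun x : ℂ × ℂ => iteratedDeriv i (fun ζ => F (x.1, ζ)) x.2) x (0, 1)) U :=
      fun x hx => analyticAt_clm_apply (ih.fderiv x hx) _
    refine h1.congr hU fun x hx => ?_
    rw [iteratedDeriv_succ]
    exact (deriv_comp_prodMk_right (ih x hx).differentiableAt).symm

end

/-! ### Normalization of kernels -/

section

variable {A : Type*} [NormedRing A] [NormedAlgebra ℂ A] [CompleteSpace A]

theorem analyticAt_ringInverse {E : Type*} [NormedAddCommGroup E] [NormedSpace ℂ E] {f : E → A}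
    {x : E} (hf : AnalyticAt ℂ f x) (h1 : f x = 1) :
    AnalyticAt ℂ (fun y => Ring.inverse (f y)) x := by
  have h2 := analyticAt_inverse (𝕜 := ℂ) (1 : Aˣ)
  rw [Units.val_one, ← h1] at h2
  exact h2.comp hf

theorem hasDerivAt_ringInverse {f : ℂ → A} {f' : A} {x : ℂ} (hf : HasDerivAt f f' x)
    (h1 : f x = 1) : HasDerivAt (fun y => Ring.inverse (f y)) (-f') x := by
  have h2 := hasFDerivAt_ringInverse (𝕜 := ℂ) (1 : Aˣ)
  rw [Units.val_one, ← h1] at h2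
  exact (h2.comp_hasDerivAt x hf).congr_deriv (by simp)

/-- The normalization of a kernel `Ψ (z, u)`, `u = w̄`: the kernel `Ψ(z,0)⁻¹ Ψ(z,u) Ψ(0,u)⁻¹`. -/
def normalization (Ψ : ℂ × ℂ → A) (x : ℂ × ℂ) : A :=
  Ring.inverse (Ψ (x.1, 0)) * Ψ x * Ring.inverse (Ψ (0, x.2))

variable {Ψ : ℂ × ℂ → A}

theorem analyticAt_normalization (h : AnalyticAt ℂ Ψ (0, 0)) (h1 : Ψ (0, 0) = 1) :
    AnalyticAt ℂ (normalization Ψ) (0, 0) := by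
  have e1 : AnalyticAt ℂ (fun x : ℂ × ℂ => Ψ (x.1, 0)) (0, 0) :=
    AnalyticAt.fun_comp (g := Ψ) (f := fun x : ℂ × ℂ => (x.1, (0 : ℂ))) h
      (analyticAt_fst.prod analyticAt_const)
  have e2 : AnalyticAt ℂ (fun x : ℂ × ℂ => Ψ (0, x.2)) (0, 0) :=
    AnalyticAt.fun_comp (g := Ψ) (f := fun x : ℂ × ℂ => ((0 : ℂ), x.2)) h
      (analyticAt_const.prod analyticAt_snd)
  exact ((analyticAt_ringInverse e1 h1).mul h).mul (analyticAt_ringInverse e2 h1)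

theorem eventually_normalization_eq_one (h : AnalyticAt ℂ Ψ (0, 0)) (h1 : Ψ (0, 0) = 1) :
    ∀ᶠ u in nhds (0 : ℂ), normalization Ψ (0, u) = 1 := by
  have h2 : ContinuousAt (fun u : ℂ => Ψ (0, u)) 0 :=
    ContinuousAt.comp (g := Ψ) (f := fun u : ℂ => ((0 : ℂ), u)) h.continuousAt (by fun_prop)
  have h3 := h2.tendsto.eventually ((Units.isOpen (R := A)).mem_nhds (by simp [h1]))
  filter_upwards [h3] with u hu
  simp only [normalization, h1, Ring.inverse_one, one_mul]
  exact Ring.mul_inverse_cancel _ hu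

theorem deriv_deriv_normalization (h : AnalyticAt ℂ Ψ (0, 0)) (h1 : Ψ (0, 0) = 1) :
    deriv (fun u => deriv (fun z => normalization Ψ (z, u)) 0) 0 =
      deriv (fun u => deriv (fun z => Ψ (z, u)) 0) 0 -
        deriv (fun z => Ψ (z, 0)) 0 * deriv (fun u => Ψ (0, u)) 0 := by
  have ht : Filter.Tendsto (fun u : ℂ => ((0 : ℂ), u)) (nhds 0) (nhds (0, 0)) :=
    (by fun_prop : Continuous fun u : ℂ => ((0 : ℂ), u)).tendsto 0
  have hl : ∀ {u : ℂ}, AnalyticAt ℂ Ψ (0, u) → DifferentiableAt ℂ (fun z => Ψ (z, u)) 0 :=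
    fun {u} hu => DifferentiableAt.comp (g := Ψ) (f := fun z : ℂ => (z, u)) 0 hu.differentiableAt
      (by fun_prop)
  have hr : DifferentiableAt ℂ (fun u => Ψ (0, u)) 0 :=
    DifferentiableAt.comp (g := Ψ) (f := fun u : ℂ => ((0 : ℂ), u)) 0 h.differentiableAt
      (by fun_prop)
  -- The derivative of `Ψ(z, 0)⁻¹` contributes the constant `-∂_z Ψ(0, 0)`, since `G(0, u) = 1`.
  have e1 : (fun u => deriv (fun z => normalization Ψ (z, u)) 0) =ᶠ[nhds 0] fun u =>
      deriv (fun z => Ψ (z, u)) 0 * Ring.inverse (Ψ (0, u)) - deriv (fun z => Ψ (z, 0)) 0 := by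
    filter_upwards [ht.eventually h.eventually_analyticAt, eventually_normalization_eq_one h h1]
      with u hu hu1
    simp only [normalization, h1, Ring.inverse_one, one_mul] at hu1
    have h2 := ((hasDerivAt_ringInverse (hl h).hasDerivAt h1).mul (hl hu).hasDerivAt).mul_const
      (Ring.inverse (Ψ (0, u)))
    refine h2.deriv.trans ?_
    rw [h1, Ring.inverse_one, one_mul, add_mul, mul_assoc, hu1, mul_one]
    abel
  have e2 : DifferentiableAt ℂ (fun u => deriv (fun z => Ψ (z, u)) 0) 0 := by
    have h3 : DifferentiableAt ℂ (fun u : ℂ => fderiv ℂ Ψ (0, u) (1, 0)) 0 :=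
      DifferentiableAt.comp (g := fun x => fderiv ℂ Ψ x (1, 0)) (f := fun u : ℂ => ((0 : ℂ), u)) 0
        (h.fderiv.differentiableAt.clm_apply (differentiableAt_const _)) (by fun_prop)
    refine h3.congr_of_eventuallyEq ?_
    filter_upwards [ht.eventually h.eventually_analyticAt] with u hu
    exact deriv_comp_prodMk_left hu.differentiableAt
  have e3 := (e2.hasDerivAt.mul (hasDerivAt_ringInverse hr.hasDerivAt h1)).sub_const
    (deriv (fun z => Ψ (z, 0)) 0)
  rw [e1.deriv_eq]
  refine e3.deriv.trans ?_
  rw [h1, Ring.inverse_one, mul_one, mul_neg, sub_eq_add_neg]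

end

/-! ### Curvature of the metric of a holomorphic kernel -/

section

open scoped Matrix.Norms.L2Operator

variable {m : Type*} [Fintype m] [DecidableEq m]

theorem hasFDerivAt_matrix_apply {E : Type*} [NormedAddCommGroup E] [NormedSpace ℂ E]
    {F : E → Matrix m m ℂ} {F' : E →L[ℂ] Matrix m m ℂ} {x : E} (h : HasFDerivAt F F' x) (i j : m) :
    HasFDerivAt (fun y => F y i j)
      ((LinearMap.toContinuousLinearMap (Matrix.entryLinearMap ℂ ℂ i j)).comp F') x :=
  (LinearMap.toContinuousLinearMap (Matrix.entryLinearMap ℂ ℂ i j)).hasFDerivAt.comp x h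

theorem deriv_matrix_apply {F : ℂ → Matrix m m ℂ} {x : ℂ} (h : DifferentiableAt ℂ F x) (i j : m) :
    deriv F x i j = deriv (fun y => F y i j) x := by
  rw [← fderiv_apply_one_eq_deriv, ← fderiv_apply_one_eq_deriv,
    (hasFDerivAt_matrix_apply h.hasFDerivAt i j).fderiv]
  rfl

theorem analyticAt_matrix {E : Type*} [NormedAddCommGroup E] [NormedSpace ℂ E]
    {F : E → Matrix m m ℂ} {x : E} (h : ∀ i j, AnalyticAt ℂ (fun y => F y i j) x) :
    AnalyticAt ℂ F x := by
  have e : F = fun y => ∑ i, ∑ j, F y i j • Matrix.single i j (1 : ℂ) := by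
    funext y
    conv_lhs => rw [Matrix.matrix_eq_sum_single (F y)]
    simp [Matrix.smul_single]
  rw [e]
  exact Finset.analyticAt_fun_sum _ fun i _ => Finset.analyticAt_fun_sum _ fun j _ =>
    (h i j).smul analyticAt_const

/-- The derivative over the reals of the restriction of a holomorphic function to the
antidiagonal `u = z̄`. -/
theorem fderiv_conj_graph {F : ℂ × ℂ → Matrix m m ℂ} {z : ℂ}
    (h : DifferentiableAt ℂ F (z, conj z)) (i j : m) (v : ℂ) :
    fderiv ℝ (fun ζ => F (ζ, conj ζ) i j) z v = fderiv ℂ F (z, conj z) (v, conj v) i j := by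
  have h1 := (hasFDerivAt_matrix_apply h.hasFDerivAt i j).restrictScalars ℝ
  have h2 : HasFDerivAt (fun ζ : ℂ => (ζ, conj ζ))
      ((ContinuousLinearMap.id ℝ ℂ).prod (Complex.conjCLE : ℂ →L[ℝ] ℂ)) z :=
    (hasFDerivAt_id z).prodMk Complex.conjCLE.hasFDerivAt
  exact congrArg (fun L => L v) (h1.comp z h2).fderiv

theorem delMatrix_conj_graph {F : ℂ × ℂ → Matrix m m ℂ} {z : ℂ}
    (h : DifferentiableAt ℂ F (z, conj z)) :
    delMatrix (fun ζ => (F (ζ, conj ζ)).transpose) z =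
      (fderiv ℂ F (z, conj z) (1, 0)).transpose := by
  ext i j
  simp only [delMatrix, Matrix.of_apply, Matrix.transpose_apply, fderiv_conj_graph h]
  have e1 : ((1 : ℂ), conj (1 : ℂ)) = (1, 0) + (0, 1) := by simp
  have e2 : (Complex.I, conj Complex.I) =
      Complex.I • ((1 : ℂ), (0 : ℂ)) - Complex.I • ((0 : ℂ), (1 : ℂ)) := by simp
  rw [e1, e2, map_add, map_sub, map_smul, map_smul]
  simp only [Matrix.add_apply, Matrix.sub_apply, Matrix.smul_apply, smul_eq_mul]
  linear_combination (1 / 2 : ℂ) * (fderiv ℂ F (z, conj z) (0, 1) j i -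
    fderiv ℂ F (z, conj z) (1, 0) j i) * Complex.I_mul_I

theorem delbarMatrix_conj_graph {F : ℂ × ℂ → Matrix m m ℂ} {z : ℂ}
    (h : DifferentiableAt ℂ F (z, conj z)) :
    delbarMatrix (fun ζ => (F (ζ, conj ζ)).transpose) z =
      (fderiv ℂ F (z, conj z) (0, 1)).transpose := by
  ext i j
  simp only [delbarMatrix, Matrix.of_apply, Matrix.transpose_apply, fderiv_conj_graph h]
  have e1 : ((1 : ℂ), conj (1 : ℂ)) = (1, 0) + (0, 1) := by simp
  have e2 : (Complex.I, conj Complex.I) =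
      Complex.I • ((1 : ℂ), (0 : ℂ)) - Complex.I • ((0 : ℂ), (1 : ℂ)) := by simp
  rw [e1, e2, map_add, map_sub, map_smul, map_smul]
  simp only [Matrix.add_apply, Matrix.sub_apply, Matrix.smul_apply, smul_eq_mul]
  linear_combination (1 / 2 : ℂ) * (fderiv ℂ F (z, conj z) (1, 0) j i -
    fderiv ℂ F (z, conj z) (0, 1) j i) * Complex.I_mul_I

theorem delbarMatrix_congr {m : Type*} {F F' : ℂ → Matrix m m ℂ} {z : ℂ} (h : F =ᶠ[nhds z] F') :
    delbarMatrix F z = delbarMatrix F' z := by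
  ext i j
  have : (fun ζ => F ζ i j) =ᶠ[nhds z] fun ζ => F' ζ i j := h.mono fun ζ hζ => by simp only [hζ]
  simp only [delbarMatrix, Matrix.of_apply, this.fderiv_eq]

/-- The curvature at `0` of the metric `G(z, z̄)ᵗ`, for a holomorphic `G` that is normalized in its
second variable. -/
theorem curvature_conj_graph {G : ℂ × ℂ → Matrix m m ℂ} (h : AnalyticAt ℂ G (0, 0))
    (h1 : ∀ᶠ u in nhds (0 : ℂ), G (0, u) = 1) :
    curvature (fun ζ => (G (ζ, conj ζ)).transpose) 0 =
      (deriv (fun u => deriv (fun z => G (z, u)) 0) 0).transpose := by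
  let R : ℂ × ℂ → Matrix m m ℂ := fun x => fderiv ℂ G x (1, 0) * Ring.inverse (G x)
  have hR : AnalyticAt ℂ R (0, 0) :=
    (analyticAt_clm_apply h.fderiv _).mul (analyticAt_ringInverse h h1.self_of_nhds)
  have ht : Filter.Tendsto (fun z : ℂ => (z, conj z)) (nhds 0) (nhds (0, 0)) := by
    have := (by fun_prop : Continuous fun z : ℂ => (z, conj z)).tendsto 0
    simpa using this
  -- Near `0` the connection form is the transpose of `(∂G/∂z) G⁻¹` on the antidiagonal, and `G = 1`
  -- for `z = 0` makes the factor `G⁻¹` irrelevant for the derivative in `u` at `0`.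
  have e1 : (fun ζ => ((G (ζ, conj ζ)).transpose)⁻¹ *
      delMatrix (fun ζ => (G (ζ, conj ζ)).transpose) ζ) =ᶠ[nhds 0]
      fun ζ => (R (ζ, conj ζ)).transpose := by
    filter_upwards [ht.eventually h.eventually_analyticAt] with ζ hζ
    rw [delMatrix_conj_graph hζ.differentiableAt, ← Matrix.transpose_nonsing_inv,
      ← Matrix.transpose_mul, Matrix.nonsing_inv_eq_ringInverse]
  have e0 : ((0 : ℂ), conj (0 : ℂ)) = (0, 0) := by simp
  rw [curvature, delbarMatrix_congr e1, delbarMatrix_conj_graph (by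
    rw [e0]; exact hR.differentiableAt), e0, ← deriv_comp_prodMk_right hR.differentiableAt]
  congr 1
  refine Filter.EventuallyEq.deriv_eq ?_
  have hr : Filter.Tendsto (fun u : ℂ => ((0 : ℂ), u)) (nhds 0) (nhds (0, 0)) :=
    (by fun_prop : Continuous fun u : ℂ => ((0 : ℂ), u)).tendsto 0
  filter_upwards [h1, hr.eventually h.eventually_analyticAt] with u hu hu'
  simp only [R]
  rw [hu, Ring.inverse_one, mul_one, deriv_comp_prodMk_left hu'.differentiableAt]

end

/-! ### Curvature of the normalized jet kernel -/

theorem jetMatrix_eq_cpow_mul (n : ℕ) (α β : ℝ) (z u : ℂ) (i j : Fin (n + 1)) :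
    jetMatrix n α β z (conj u) i j = (1 - z * u) ^ (-α : ℂ) *
      iteratedDeriv j (fun u => iteratedDeriv i (fun ζ => (1 - ζ * u) ^ (-β : ℂ)) z) u := by
  simp only [jetMatrix, Matrix.of_apply, bidiscKernel, Complex.conj_conj]
  simp only [iteratedDeriv_const_mul_field]

theorem analyticOnNhd_cpow (a : ℝ) : AnalyticOnNhd ℂ (fun x : ℂ × ℂ => (1 - x.1 * x.2) ^ (-a : ℂ))
    (Metric.ball 0 1 ×ˢ Metric.ball 0 1) := by
  rintro ⟨z, u⟩ ⟨hz, hu⟩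
  have h : ‖z * u‖ < 1 := by
    rw [norm_mul]
    have h1 : ‖z‖ < 1 := by simpa using hz
    have h2 : ‖u‖ < 1 := by simpa using hu
    nlinarith [norm_nonneg z, norm_nonneg u]
  have h3 := Complex.mem_slitPlane_of_norm_lt_one (z := -(z * u)) (by simpa using h)
  exact (analyticAt_const.sub (analyticAt_fst.mul analyticAt_snd)).cpow analyticAt_const
    (by simpa [sub_eq_add_neg] using h3)

theorem analyticAt_jetMatrix (n : ℕ) (α β : ℝ) (i j : Fin (n + 1)) :
    AnalyticAt ℂ (fun x : ℂ × ℂ => jetMatrix n α β x.1 (conj x.2) i j) (0, 0) := by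
  have hU : IsOpen (Metric.ball (0 : ℂ) 1 ×ˢ Metric.ball (0 : ℂ) 1) :=
    Metric.isOpen_ball.prod Metric.isOpen_ball
  have h0 : ((0 : ℂ), (0 : ℂ)) ∈ Metric.ball (0 : ℂ) 1 ×ˢ Metric.ball (0 : ℂ) 1 := by simp
  have h1 := analyticOnNhd_iteratedDeriv_right hU
    (analyticOnNhd_iteratedDeriv_left hU (analyticOnNhd_cpow β) i) j
  simp only [jetMatrix_eq_cpow_mul]
  exact (analyticOnNhd_cpow α _ h0).mul (h1 _ h0)

theorem deriv_jetMatrix_left (n : ℕ) (α β : ℝ) (i j : Fin (n + 1)) :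
    deriv (fun z => jetMatrix n α β z (conj 0) i j) 0 =
      if (j : ℕ) = i + 1 then (diagEntry β j : ℂ) else 0 := by
  have h : (fun z => jetMatrix n α β z (conj 0) i j) =ᶠ[nhds 0]
      fun z => pochCoeff β j * (j : ℕ).factorial * jetMonomial i 0 j z := by
    filter_upwards [Metric.ball_mem_nhds (0 : ℂ) one_pos] with z hz
    rw [map_zero, jetMatrix_zero_right n α β (by simpa using hz)]
  rw [h.deriv_eq, deriv_const_mul_field]
  change _ * deriv (jetMonomial i 0 j) 0 = _
  rw [deriv_jetMonomial_zero]
  by_cases h4 : (j : ℕ) = i + 1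
  · simp [h4, diagEntry, pow_two, mul_assoc]
  · simp [h4]

theorem deriv_jetMatrix_right (n : ℕ) (α β : ℝ) (i j : Fin (n + 1)) :
    deriv (fun u => jetMatrix n α β 0 (conj u) i j) 0 =
      if (i : ℕ) = j + 1 then (diagEntry β i : ℂ) else 0 := by
  have h : (fun u => jetMatrix n α β 0 (conj u) i j) =ᶠ[nhds 0]
      fun u => pochCoeff β i * (i : ℕ).factorial * jetMonomial j 0 i u := by
    filter_upwards [Metric.ball_mem_nhds (0 : ℂ) one_pos] with u hu
    rw [jetMatrix_zero_left n α β (by simpa using hu)]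
    simp [jetMonomial]
  rw [h.deriv_eq, deriv_const_mul_field]
  change _ * deriv (jetMonomial j 0 i) 0 = _
  rw [deriv_jetMonomial_zero]
  by_cases h4 : (i : ℕ) = j + 1
  · simp [h4, diagEntry, pow_two, mul_assoc]
  · simp [h4]

theorem deriv_deriv_jetMatrix (n : ℕ) (α β : ℝ) (i j : Fin (n + 1)) :
    deriv (fun z => deriv (fun u => jetMatrix n α β z (conj u) i j) 0) 0 =
      if i = j then ((α * diagEntry β j + diagEntry β (j + 1) : ℝ) : ℂ) else 0 := by
  have h : (fun z => deriv (fun u => jetMatrix n α β z (conj u) i j) 0) =ᶠ[nhds 0]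
      kernelDerivEntry α β i j := by
    filter_upwards [Metric.ball_mem_nhds (0 : ℂ) one_pos] with z hz
    rw [deriv_zero_of_hasSum_jetMonomial (d := fun t =>
      ((pochCoeff α t.1 * pochCoeff β t.2 : ℝ) : ℂ) * jetMonomial i t.1 t.2 z) j]
    · simp only [kernelDerivEntry, pochCoeff_zero, pochCoeff_one]
      push_cast
      ring
    · intro u hu
      refine hasSum_of_eq (hasSum_jetMatrix n α β z (conj u) (by simpa using hz)
        (by simpa using hu) i j) fun t => ?_
      simp [jetMonomial, mul_assoc]
  rw [h.deriv_eq, deriv_kernelDerivEntry]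
  simp only [Fin.ext_iff]

open scoped ComplexOrder MatrixOrder Matrix.Norms.L2Operator in
theorem sqrt_jetMatrix (n : ℕ) (α : ℝ) {β : ℝ} (hβ : 0 < β) :
    CFC.sqrt (jetMatrix n α β 0 0) =
      Matrix.diagonal fun i : Fin (n + 1) => ((√(diagEntry β i) : ℝ) : ℂ) := by
  rw [jetMatrix_zero_zero]
  refine CFC.sqrt_unique ?_ ?_
  · rw [Matrix.diagonal_mul_diagonal]
    congr 1
    funext i
    rw [← Complex.ofReal_mul, Real.mul_self_sqrt (diagEntry_pos hβ i).le]
  · refine (Matrix.PosSemidef.diagonal fun i => ?_).nonneg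
    simp [Real.sqrt_nonneg]

open scoped MatrixOrder Matrix.Norms.L2Operator in
theorem inv_sqrt_jetMatrix (n : ℕ) (α : ℝ) {β : ℝ} (hβ : 0 < β) :
    (CFC.sqrt (jetMatrix n α β 0 0))⁻¹ =
      Matrix.diagonal fun i : Fin (n + 1) => ((√(diagEntry β i))⁻¹ : ℂ) := by
  rw [sqrt_jetMatrix n α hβ]
  refine Matrix.inv_eq_right_inv ?_
  rw [Matrix.diagonal_mul_diagonal, ← Matrix.diagonal_one]
  congr 1
  funext i
  refine mul_inv_cancel₀ ?_
  exact_mod_cast (Real.sqrt_pos.mpr (diagEntry_pos hβ i)).ne'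

theorem scaledKernel_apply (n : ℕ) (α : ℝ) {β : ℝ} (hβ : 0 < β) (z w : ℂ) (i j : Fin (n + 1)) :
    scaledKernel n α β z w i j =
      (√(diagEntry β i) : ℂ)⁻¹ * (√(diagEntry β j) : ℂ)⁻¹ * jetMatrix n α β z w i j := by
  rw [scaledKernel, inv_sqrt_jetMatrix n α hβ, Matrix.mul_diagonal, Matrix.diagonal_mul]
  ring

section

open scoped Matrix.Norms.L2Operator

theorem deriv_deriv_matrix_apply {m : Type*} [Fintype m] [DecidableEq m]
    {F : ℂ × ℂ → Matrix m m ℂ} (h : AnalyticAt ℂ F (0, 0)) (i j : m) :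
    deriv (fun u => deriv (fun z => F (z, u)) 0) 0 i j =
      deriv (fun z => deriv (fun u => F (z, u) i j) 0) 0 := by
  have ht : Filter.Tendsto (fun z : ℂ => (z, (0 : ℂ))) (nhds 0) (nhds (0, 0)) :=
    (by fun_prop : Continuous fun z : ℂ => (z, (0 : ℂ))).tendsto 0
  have hr : ∀ {z : ℂ}, AnalyticAt ℂ F (z, 0) → DifferentiableAt ℂ (fun u => F (z, u)) 0 :=
    fun {z} hz => DifferentiableAt.comp (g := F) (f := fun u : ℂ => (z, u)) 0 hz.differentiableAt
      (by fun_prop)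
  have hd : DifferentiableAt ℂ (fun z => deriv (fun u => F (z, u)) 0) 0 := by
    have h3 : DifferentiableAt ℂ (fun z : ℂ => fderiv ℂ F (z, 0) (0, 1)) 0 :=
      DifferentiableAt.comp (g := fun x => fderiv ℂ F x (0, 1)) (f := fun z : ℂ => (z, (0 : ℂ))) 0
        (h.fderiv.differentiableAt.clm_apply (differentiableAt_const _)) (by fun_prop)
    refine h3.congr_of_eventuallyEq ?_
    filter_upwards [ht.eventually h.eventually_analyticAt] with z hz
    exact deriv_comp_prodMk_right hz.differentiableAt
  rw [deriv_deriv_comm h, deriv_matrix_apply hd]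
  refine Filter.EventuallyEq.deriv_eq ?_
  filter_upwards [ht.eventually h.eventually_analyticAt] with z hz
  exact deriv_matrix_apply (hr hz) i j

theorem analyticAt_scaledKernel (n : ℕ) (α : ℝ) {β : ℝ} (hβ : 0 < β) :
    AnalyticAt ℂ (fun x : ℂ × ℂ => scaledKernel n α β x.1 (conj x.2)) (0, 0) := by
  refine analyticAt_matrix fun i j => ?_
  simp only [scaledKernel_apply n α hβ]
  exact analyticAt_const.mul (analyticAt_jetMatrix n α β i j)

theorem sqrt_diagEntry_mul_self {β : ℝ} (hβ : 0 < β) (i : ℕ) :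
    (√(diagEntry β i) : ℂ) * √(diagEntry β i) = diagEntry β i := by
  rw [← Complex.ofReal_mul, Real.mul_self_sqrt (diagEntry_pos hβ i).le]

theorem sqrt_diagEntry_ne_zero {β : ℝ} (hβ : 0 < β) (i : ℕ) :
    (√(diagEntry β i) : ℂ) ≠ 0 := by
  exact_mod_cast (Real.sqrt_pos.mpr (diagEntry_pos hβ i)).ne'

theorem scaledKernel_zero_zero (n : ℕ) (α : ℝ) {β : ℝ} (hβ : 0 < β) :
    scaledKernel n α β 0 0 = 1 := by
  ext i j
  rw [scaledKernel_apply n α hβ, jetMatrix_zero_zero, Matrix.diagonal_apply, Matrix.one_apply]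
  split_ifs with h
  · subst h
    rw [← sqrt_diagEntry_mul_self hβ]
    field_simp [sqrt_diagEntry_ne_zero hβ i]
  · rw [mul_zero]

theorem deriv_scaledKernel_left (n : ℕ) (α : ℝ) {β : ℝ} (hβ : 0 < β) (i j : Fin (n + 1)) :
    deriv (fun z => scaledKernel n α β z (conj 0)) 0 i j =
      if (j : ℕ) = i + 1 then (√(diagEntry β i) : ℂ)⁻¹ * √(diagEntry β j) else 0 := by
  have hd : DifferentiableAt ℂ (fun z => scaledKernel n α β z (conj 0)) 0 :=
    DifferentiableAt.comp (g := fun x : ℂ × ℂ => scaledKernel n α β x.1 (conj x.2))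
      (f := fun z : ℂ => (z, (0 : ℂ))) 0 (analyticAt_scaledKernel n α hβ).differentiableAt
      (by fun_prop)
  rw [deriv_matrix_apply hd]
  simp only [scaledKernel_apply n α hβ]
  rw [deriv_const_mul_field, deriv_jetMatrix_left, mul_ite, mul_zero, ← sqrt_diagEntry_mul_self hβ,
    mul_assoc, inv_mul_cancel_left₀ (sqrt_diagEntry_ne_zero hβ _)]

theorem deriv_scaledKernel_right (n : ℕ) (α : ℝ) {β : ℝ} (hβ : 0 < β) (i j : Fin (n + 1)) :
    deriv (fun u => scaledKernel n α β 0 (conj u)) 0 i j =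
      if (i : ℕ) = j + 1 then (√(diagEntry β j) : ℂ)⁻¹ * √(diagEntry β i) else 0 := by
  have hd : DifferentiableAt ℂ (fun u => scaledKernel n α β 0 (conj u)) 0 :=
    DifferentiableAt.comp (g := fun x : ℂ × ℂ => scaledKernel n α β x.1 (conj x.2))
      (f := fun u : ℂ => ((0 : ℂ), u)) 0 (analyticAt_scaledKernel n α hβ).differentiableAt
      (by fun_prop)
  rw [deriv_matrix_apply hd]
  simp only [scaledKernel_apply n α hβ]
  rw [deriv_const_mul_field, deriv_jetMatrix_right, mul_ite, mul_zero,
    ← sqrt_diagEntry_mul_self hβ, mul_comm (_ : ℂ)⁻¹, mul_assoc,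
    inv_mul_cancel_left₀ (sqrt_diagEntry_ne_zero hβ _)]

theorem deriv_deriv_scaledKernel (n : ℕ) (α : ℝ) {β : ℝ} (hβ : 0 < β) (i j : Fin (n + 1)) :
    deriv (fun u => deriv (fun z => scaledKernel n α β z (conj u)) 0) 0 i j =
      if i = j then ((α + diagEntry β (j + 1) / diagEntry β j : ℝ) : ℂ) else 0 := by
  refine (deriv_deriv_matrix_apply (analyticAt_scaledKernel n α hβ) i j).trans ?_
  simp only [scaledKernel_apply n α hβ, deriv_const_mul_field]
  rw [deriv_deriv_jetMatrix, mul_ite, mul_zero]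
  split_ifs with h
  · have h1 : ((diagEntry β j : ℝ) : ℂ) ≠ 0 := by exact_mod_cast (diagEntry_pos hβ j).ne'
    rw [h, ← mul_inv, sqrt_diagEntry_mul_self hβ]
    push_cast
    field_simp
  · rfl

theorem normalizedKernel_eq_normalization (n : ℕ) (α β : ℝ) (x : ℂ × ℂ) :
    normalizedKernel n α β x.1 (conj x.2) =
      normalization (fun x : ℂ × ℂ => scaledKernel n α β x.1 (conj x.2)) x := by
  simp only [normalization, normalizedKernel, Matrix.nonsing_inv_eq_ringInverse, map_zero]

/-- The mixed derivative at `0` of the normalized kernel. The first summand of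
`deriv_deriv_normalization` has the diagonal entries `α + D (j + 1) / D j`, where `D j` are the
diagonal entries of the jet kernel at `(0, 0)`; the second one cancels `D (j + 1) / D j` in all of
them but the last. -/
theorem deriv_deriv_normalizedKernel (n : ℕ) (α : ℝ) {β : ℝ} (hβ : 0 < β) :
    deriv (fun u => deriv (fun z => normalizedKernel n α β z (conj u)) 0) 0 =
      Matrix.diagonal fun j => (curvatureEigenvalue n α β j : ℂ) := by
  have h := analyticAt_scaledKernel n α hβ
  have h1 : scaledKernel n α β ((0 : ℂ), (0 : ℂ)).1 (conj ((0 : ℂ), (0 : ℂ)).2) = 1 := by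
    simpa using scaledKernel_zero_zero n α hβ
  have e := deriv_deriv_normalization h h1
  simp only [← normalizedKernel_eq_normalization] at e
  rw [e]
  ext i j
  rw [Matrix.sub_apply, deriv_deriv_scaledKernel n α hβ, Matrix.mul_apply, Matrix.diagonal_apply]
  simp only [deriv_scaledKernel_left n α hβ, deriv_scaledKernel_right n α hβ]
  have hD : (diagEntry β j : ℂ) ≠ 0 := by exact_mod_cast (diagEntry_pos hβ j).ne'
  by_cases hij : i = j
  · subst hij
    rw [if_pos rfl, if_pos rfl, curvatureEigenvalue]
    by_cases hi : i = Fin.last n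
    · rw [if_pos hi, Finset.sum_eq_zero, sub_zero, diagEntry_succ,
        mul_div_cancel_right₀ _ (diagEntry_pos hβ _).ne', hi, Fin.val_last]
      intro k _
      rw [if_neg (by rw [hi, Fin.val_last]; omega), zero_mul]
    · have hi' : (i : ℕ) < n := by
        rw [Fin.ext_iff, Fin.val_last] at hi
        omega
      rw [if_neg hi, Finset.sum_eq_single ⟨i + 1, by omega⟩]
      · rw [if_pos rfl, mul_mul_mul_comm, ← mul_inv, sqrt_diagEntry_mul_self hβ,
          sqrt_diagEntry_mul_self hβ]
        push_cast
        field_simp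
        ring
      · intro k _ hk
        rw [if_neg (fun h => hk (Fin.ext h)), zero_mul]
      · simp
  · rw [if_neg hij, if_neg hij, Finset.sum_eq_zero, sub_zero]
    intro k _
    by_cases h3 : (k : ℕ) = i + 1
    · rw [if_neg (fun h4 : (k : ℕ) = j + 1 => hij (Fin.ext (by omega))), mul_zero]
    · rw [if_neg h3, zero_mul]

theorem curvature_bundleMetric (n : ℕ) (α : ℝ) {β : ℝ} (hβ : 0 < β) :
    curvature (bundleMetric n α β) 0 =
      (deriv (fun u => deriv (fun z => normalizedKernel n α β z (conj u)) 0) 0).transpose := by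
  have h := analyticAt_scaledKernel n α hβ
  have h1 : scaledKernel n α β ((0 : ℂ), (0 : ℂ)).1 (conj ((0 : ℂ), (0 : ℂ)).2) = 1 := by
    simpa using scaledKernel_zero_zero n α hβ
  have e := curvature_conj_graph (analyticAt_normalization h h1)
    (eventually_normalization_eq_one h h1)
  simp only [← normalizedKernel_eq_normalization, Complex.conj_conj] at e
  exact e

theorem coeffOneOne_normalizedKernel (n : ℕ) (α : ℝ) {β : ℝ} (hβ : 0 < β) :
    coeffOneOne (normalizedKernel n α β) =
      deriv (fun u => deriv (fun z => normalizedKernel n α β z (conj u)) 0) 0 := by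
  have h := analyticAt_scaledKernel n α hβ
  have h1 : scaledKernel n α β ((0 : ℂ), (0 : ℂ)).1 (conj ((0 : ℂ), (0 : ℂ)).2) = 1 := by
    simpa using scaledKernel_zero_zero n α hβ
  ext i j
  have e := deriv_deriv_matrix_apply (analyticAt_normalization h h1) i j
  simp only [← normalizedKernel_eq_normalization] at e
  exact e.symm
end

end
end BidiscJet

theorem mainTheorem2 (n : ℕ) (hn : 1 ≤ n) (α β α' β' : ℝ)
    [Fact (0 < α)] [Fact (0 < β)] [Fact (0 < α')] [Fact (0 < β')] :
    (BidiscJet.UnitarilyEquivalent (BidiscJet.jetMul n α β) (BidiscJet.jetMul n α' β') ↔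
      α = α' ∧ β = β') ∧
    BidiscJet.curvature (BidiscJet.bundleMetric n α β) 0 =
      (BidiscJet.coeffOneOne (BidiscJet.normalizedKernel n α β)).transpose ∧
    BidiscJet.curvature (BidiscJet.bundleMetric n α β) 0 =
      Matrix.diagonal (fun i : Fin (n + 1) =>
        if i = Fin.last n then ((α + (n + 1) * (β + n) : ℝ) : ℂ) else (α : ℂ)) := by
  have hβ : 0 < β := Fact.out
  refine ⟨BidiscJet.unitarilyEquivalent_jetMul_iff n hn α β α' β', ?_, ?_⟩
  · rw [BidiscJet.curvature_bundleMetric n α hβ, BidiscJet.coeffOneOne_normalizedKernel n α hβ]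
  · rw [BidiscJet.curvature_bundleMetric n α hβ, BidiscJet.deriv_deriv_normalizedKernel n α hβ,
      Matrix.diagonal_transpose]
    congr 1
    funext i
    rw [BidiscJet.curvatureEigenvalue]
    split_ifs <;> rfl
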